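/- Let $K$ be a field and let $G$ be a finite simple graph with non-empty vertex set $V(G)$. For a finite simple graph $H$ put $S_H=K[x_i,y_i : i\in V(H)]$ (standard graded) and let $J_H=(x_iy_j-x_jy_i : \{i,j\}\in E(H))\subseteq S_H$ be its binomial edge ideal. Write $\mathrm{Hilb}_{S_H/J_H}(t)=\sum_{k\ge 0}\dim_K (S_H/J_H)_k\,t^k$ for the Hilbert series and $\dim(S_H/J_H)$ for the Krull dimension. If $d=\dim(S_H/J_H)>0$, write the Hilbert polynomial of $S_H/J_H$ as $\sum_{i=0}^{d-1}(-1)^{d-1-i}e_{d-1-i}\binom{X+i}{i}$ with integers $e_j$; then $e(S_H/J_H)=e_0$ is the multiplicity. A vertex of a graph is free if it belongs to exactly one maximal clique. A subgraph $H$ of $G$ is said to be glued from $H_1$ and $H_2$ if $H_1,H_2$ are induced subgraphs of $G$, $H=H_1\cup H_2$, and $V(H_1)\cap V(H_2)=\{v\}$ for a vertex $v$ that is free in $H_1$ and in $H_2$. (1) If $G$ is glued from $G_1$ and $G_2$, then $$\mathrm{Hilb}_{S_G/J_G}(t)=(1-t)^2\,\mathrm{Hilb}_{S_{G_1}/J_{G_1}}(t)\,\mathrm{Hilb}_{S_{G_2}/J_{G_2}}(t),$$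 $$\dim(S_G/J_G)=\dim(S_{G_1}/J_{G_1})+\dim(S_{G_2}/J_{G_2})-2,\qquad e(S_G/J_G)=e(S_{G_1}/J_{G_1})\,e(S_{G_2}/J_{G_2}).$$ (2) Call a list of subgraphs a decomposition of a subgraph $H$ of $G$ if it is obtained by repeated splitting: the one-term list $(H)$ is a decomposition of $H$; and if $H$ is glued from $H_1$ and $H_2$, then the concatenation of a decomposition of $H_1$ and a decomposition of $H_2$ is a decomposition of $H$. If $(G_1,\dots,G_r)$ is a decomposition of $G$ (for instance, one whose members cannot be split further except by splitting off a single vertex), then $$\mathrm{Hilb}_{S_G/J_G}(t)=(1-t)^{2r-2}\prod_{i=1}^r\mathrm{Hilb}_{S_{G_i}/J_{G_i}}(t),$$ $$\dim(S_G/J_G)=\sum_{i=1}^r\dim(S_{G_i}/J_{G_i})-2r+2,\qquad e(S_G/J_G)=\prod_{i=1}^r e(S_{G_i}/J_{G_i}).$$ -/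

import Mathlib

namespace BinomialEdge

open Filter

/-! ### Graphs: free vertices, gluing, iterated decomposition -/

/-- A free vertex: a vertex that belongs to exactly one maximal clique. -/
def IsFreeVertex {V : Type*} (G : SimpleGraph V) (v : V) : Prop :=
  ∃! U : Set V, Maximal G.IsClique U ∧ v ∈ U

/-- `H = H₁ ∪ H₂`, where `H₁` and `H₂` are induced subgraphs, `V(H₁) ∩ V(H₂) = {v}`, and `v` is a
free vertex of `H₁` and of `H₂`. (Here `H` is a subgraph of an ambient graph `G`; for `H = ⊤` this
is a decomposition of `G` itself.) -/
structure IsFreeGluing {V : Type*} {G : SimpleGraph V} (H H₁ H₂ : G.Subgraph) (v : V) : Prop where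
  induced_left : H₁.IsInduced
  induced_right : H₂.IsInduced
  union_eq : H₁ ⊔ H₂ = H
  inter_eq : H₁.verts ∩ H₂.verts = {v}
  free_left : ∃ hv : v ∈ H₁.verts, IsFreeVertex H₁.coe ⟨v, hv⟩
  free_right : ∃ hv : v ∈ H₂.verts, IsFreeVertex H₂.coe ⟨v, hv⟩

/-- `IsDecomposition H L`: the list `L` of subgraphs is obtained from `H` by repeatedly decomposing
along a common free vertex (the pieces may, but need not, be indecomposable). -/
inductive IsDecomposition {V : Type*} {G : SimpleGraph V} : G.Subgraph → List G.Subgraph → Prop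
  | single (H : G.Subgraph) : IsDecomposition H [H]
  | glue {H H₁ H₂ : G.Subgraph} {L₁ L₂ : List G.Subgraph} (v : V) (h : IsFreeGluing H H₁ H₂ v)
      (h₁ : IsDecomposition H₁ L₁) (h₂ : IsDecomposition H₂ L₂) : IsDecomposition H (L₁ ++ L₂)

/-! ### The Hilbert series and the multiplicity of `S ⧸ I`, where `S` is a polynomial ring -/

section Hilbert

variable {σ K : Type*} [Field K]

/-- The degree `k` part of `S ⧸ I`: the residue classes of the homogeneous polynomials of
degree `k`. For a homogeneous ideal `I` these parts form the standard grading of `S ⧸ I`. -/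
noncomputable def gradedPart (I : Ideal (MvPolynomial σ K)) (k : ℕ) :
    Submodule K (MvPolynomial σ K ⧸ I) :=
  (MvPolynomial.homogeneousSubmodule σ K k).map (Ideal.Quotient.mkₐ K I).toLinearMap

/-- The Hilbert function of `S ⧸ I`. (The length of a graded part is its dimension over `K`; it is
finite when there are finitely many variables.) -/
noncomputable def hilbertFunction (I : Ideal (MvPolynomial σ K)) (k : ℕ) : ℕ :=
  Module.finrank K (gradedPart I k)

/-- The Hilbert series of `S ⧸ I`. -/
noncomputable def hilbertSeries (I : Ideal (MvPolynomial σ K)) : PowerSeries ℤ :=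
  PowerSeries.mk fun k => (hilbertFunction I k : ℤ)

/-- The Hilbert polynomial of `S ⧸ I` is `∑_{i < d} (-1)^(d-1-i) e_{d-1-i} binom(X+i, i)`, that is,
this polynomial takes the value of the Hilbert function at every large `k`. -/
def HasHilbertCoefficients (I : Ideal (MvPolynomial σ K)) (d : ℕ) (e : ℕ → ℤ) : Prop :=
  ∀ᶠ k : ℕ in atTop, (hilbertFunction I k : ℤ) =
    ∑ i ∈ Finset.range d, (-1) ^ (d - 1 - i) * e (d - 1 - i) * ((k + i).choose i : ℤ)

/-- The integer `m` is the multiplicity `e₀` of `S ⧸ I`, a ring of positive Krull dimension `d`: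
the leading one of the coefficients of its Hilbert polynomial. -/
def IsMultiplicity (I : Ideal (MvPolynomial σ K)) (m : ℤ) : Prop :=
  ∃ d : ℕ, 0 < d ∧ ringKrullDim (MvPolynomial σ K ⧸ I) = d ∧
    ∃ e : ℕ → ℤ, HasHilbertCoefficients I d e ∧ e 0 = m

theorem top_coeff_eq_zero (d : ℕ) (c : ℕ → ℤ)
    (h : ∀ᶠ k : ℕ in atTop, ∑ i ∈ Finset.range (d + 1), c i * ((k + i).choose i : ℤ) = 0) :
    c d = 0 := by
  induction d generalizing c with
  | zero =>
    obtain ⟨k, hk⟩ := h.exists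
    simpa using hk
  | succ d ih =>
    refine ih (fun i => c (i + 1)) ?_
    obtain ⟨N, hN⟩ := eventually_atTop.1 h
    refine eventually_atTop.2 ⟨N + 1, fun k hk => ?_⟩
    obtain ⟨k, rfl⟩ : ∃ j, k = j + 1 := ⟨k - 1, by omega⟩
    have h1 := hN (k + 1) (by omega)
    have h0 := hN k (by omega)
    rw [Finset.sum_range_succ'] at h1 h0
    have h2 : ∑ i ∈ Finset.range (d + 1), c (i + 1) * ((k + 1 + i).choose i : ℤ) =
        ∑ i ∈ Finset.range (d + 1), c (i + 1) * ((k + 1 + (i + 1)).choose (i + 1) : ℤ) -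
        ∑ i ∈ Finset.range (d + 1), c (i + 1) * ((k + (i + 1)).choose (i + 1) : ℤ) := by
      rw [← Finset.sum_sub_distrib]
      refine Finset.sum_congr rfl fun i _ => ?_
      have h3 : k + 1 + (i + 1) = (k + 1 + i) + 1 := by ring
      have h4 : k + (i + 1) = k + 1 + i := by ring
      rw [h3, h4, Nat.choose_succ_succ]
      push_cast
      ring
    rw [h2]
    simp only [add_zero, Nat.choose_zero_right] at h1 h0
    linarith

/-- The multiplicity is unique. -/
theorem IsMultiplicity.unique {I : Ideal (MvPolynomial σ K)} {m m' : ℤ}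
    (h : IsMultiplicity I m) (h' : IsMultiplicity I m') : m = m' := by
  obtain ⟨d, hd, hdim, e, he, rfl⟩ := h
  obtain ⟨d', -, hdim', e', he', rfl⟩ := h'
  obtain rfl : d = d' := by
    have := hdim.symm.trans hdim'
    exact_mod_cast this
  obtain ⟨d, rfl⟩ : ∃ j, d = j + 1 := ⟨d - 1, by omega⟩
  have key := top_coeff_eq_zero d
    (fun i => (-1) ^ (d + 1 - 1 - i) * (e (d + 1 - 1 - i) - e' (d + 1 - 1 - i))) (by
      filter_upwards [he, he'] with k hk hk'
      have h0 := hk.symm.trans hk'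
      rw [← sub_eq_zero, ← Finset.sum_sub_distrib] at h0
      rw [← h0]
      refine Finset.sum_congr rfl fun i _ => ?_
      ring)
  simpa [sub_eq_zero] using key

end Hilbert

/-! ### Binomial edge ideals -/

/-- The binomial edge ideal of `G` in `S = K[x_i, y_i : i ∈ V]`, generated by the binomials
`x_i y_j - x_j y_i` of the edges `{i, j}`. The variable `x_i` is `X (Sum.inl i)` and `y_i` is
`X (Sum.inr i)`. Both orders of an edge are listed; they give the same generator up to sign. -/
noncomputable def binomialEdgeIdeal (K : Type*) [Field K] {V : Type*} (G : SimpleGraph V) :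
    Ideal (MvPolynomial (V ⊕ V) K) :=
  Ideal.span {f | ∃ i j : V, G.Adj i j ∧
    f = MvPolynomial.X (Sum.inl i) * MvPolynomial.X (Sum.inr j) -
      MvPolynomial.X (Sum.inl j) * MvPolynomial.X (Sum.inr i)}

/-- The Krull dimension of `S ⧸ J_G`. -/
noncomputable def edgeDim (K : Type*) [Field K] {V : Type*} (G : SimpleGraph V) : WithBot ℕ∞ :=
  ringKrullDim (MvPolynomial (V ⊕ V) K ⧸ binomialEdgeIdeal K G)

end BinomialEdge

/-! Everything follows from the Hilbert series identity for one gluing. To compare different induced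
subgraphs inside a single polynomial ring, `G[D]` is represented by `inducedIdeal K G D`, where the
variables of the vertices outside `D` are added as generators.

The engine is Ohtani's decomposition at a vertex `u`. Let `G_u` be `G` with the neighbours of `u`
made pairwise adjacent. Then `J_G` is the intersection of `J_{G_u}` with the ideal of `G - u`
(variables of `u` included), and the sum of these two ideals is the ideal of `G_u - u`. Counting
dimensions gives `Hilb(G) + Hilb(G_u - u) = Hilb(G_u) + Hilb(G - u)` (`hilbertSeries_completeAt`).
If some vertex `u` of one part is not simplicial there, then `u ≠ v`; passing to `G_u` or deleting
`u` keeps the gluing at `v` and leaves the other part alone, while fewer ordered pairs are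
non-adjacent. As the gluing formula is linear in the series of the part containing `u`, induction
applies (`IsGluedAt.inducedSeries_eq`).

When all vertices are simplicial, each part is a disjoint union of cliques. Disjoint unions multiply
Hilbert series (`hilbertSeries_union_disjoint`), so only two cliques sharing `v` remain. Ohtani's
relation at `v` reduces them to cliques, whose series is `(1 + (n-1)t)/(1-t)^(n+1)`
(`hilbertSeries_top`).

For dimension and multiplicity, the same recursion shows that the series has the form `Q(t)/(1-t)^d`
with `Q(1) ≠ 0`. By Noether normalization and growth of the Hilbert function, `d` is the Krull
dimension (`ringKrullDim_eq_of_hilbertSeries`), and `Q(1)` is the multiplicity. In the gluing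
formula the numbers `Q(1)` multiply and the exponents add up to `d₁ + d₂ - 2`. Decompositions follow
by induction on the splitting. -/

namespace BinomialEdge

open MvPolynomial

/-! ### Hilbert functions of graded quotients -/

section HilbertFunction

variable {σ τ K : Type*} [Field K]

/-- An ideal that contains the homogeneous components of its elements. -/
def IsGradedIdeal (I : Ideal (MvPolynomial σ K)) : Prop :=
  ∀ p ∈ I, ∀ n, homogeneousComponent n p ∈ I

theorem isGradedIdeal_span {s : Set (MvPolynomial σ K)}
    (h : ∀ f ∈ s, ∃ n, f.IsHomogeneous n) : IsGradedIdeal (Ideal.span s) := by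
  let _ := MvPolynomial.gradedAlgebra (σ := σ) (R := K)
  intro p hp n
  refine homogeneousComponent_mem_of_mem (R := K) ?_ hp n
  refine Ideal.homogeneous_span _ _ fun x hx => ?_
  obtain ⟨n, hn⟩ := h x hx
  exact ⟨n, hn⟩

instance finite_homogeneousSubmodule [Finite σ] (k : ℕ) :
    Module.Finite K (homogeneousSubmodule σ K k) :=
  Module.Finite.iff_fg.2 (homogeneousSubmodule_fg σ K k)

instance finite_gradedPart [Finite σ] (I : Ideal (MvPolynomial σ K)) (k : ℕ) :
    Module.Finite K (gradedPart I k) :=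
  Module.Finite.map _ _

theorem mem_gradedPart {I : Ideal (MvPolynomial σ K)} {k : ℕ} {r : MvPolynomial σ K ⧸ I} :
    r ∈ gradedPart I k ↔ ∃ p : MvPolynomial σ K, p.IsHomogeneous k ∧ Ideal.Quotient.mk I p = r :=
  Iff.rfl

/-- The homogeneous elements of degree `k` of an ideal. -/
noncomputable def idealPart (I : Ideal (MvPolynomial σ K)) (k : ℕ) :
    Submodule K (MvPolynomial σ K) :=
  homogeneousSubmodule σ K k ⊓ I.restrictScalars K

instance finite_idealPart [Finite σ] (I : Ideal (MvPolynomial σ K)) (k : ℕ) :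
    Module.Finite K (idealPart I k) :=
  Submodule.finiteDimensional_of_le (inf_le_left : idealPart I k ≤ homogeneousSubmodule σ K k)

theorem hilbertFunction_add_finrank_idealPart [Finite σ] (I : Ideal (MvPolynomial σ K)) (k : ℕ) :
    hilbertFunction I k + Module.finrank K (idealPart I k) =
      Module.finrank K (homogeneousSubmodule σ K k) := by
  have h := LinearMap.finrank_range_add_finrank_ker
    ((Ideal.Quotient.mkₐ K I).toLinearMap.domRestrict (homogeneousSubmodule σ K k))
  rw [← h]
  congr 1
  · rw [hilbertFunction, gradedPart, LinearMap.range_domRestrict]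
  · have h2 : idealPart I k = (LinearMap.ker
        ((Ideal.Quotient.mkₐ K I).toLinearMap.domRestrict (homogeneousSubmodule σ K k))).map
          (homogeneousSubmodule σ K k).subtype := by
      ext p
      simp only [idealPart, Submodule.mem_inf, Submodule.mem_map, LinearMap.mem_ker,
        Submodule.restrictScalars_mem]
      constructor
      · rintro ⟨h1, h2⟩
        exact ⟨⟨p, h1⟩, Ideal.Quotient.eq_zero_iff_mem.2 h2, rfl⟩
      · rintro ⟨q, h1, rfl⟩
        exact ⟨q.2, Ideal.Quotient.eq_zero_iff_mem.1 h1⟩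
    rw [h2, Submodule.finrank_map_subtype_eq]

/-- This is the dimension formula for two subspaces in degree `k`. Gradedness is what makes the
degree `k` part of `I ⊔ J` the sum of the degree `k` parts. -/
theorem hilbertFunction_inf_add_sup [Finite σ] {I J : Ideal (MvPolynomial σ K)}
    (hI : IsGradedIdeal I) (hJ : IsGradedIdeal J) (k : ℕ) :
    hilbertFunction (I ⊓ J) k + hilbertFunction (I ⊔ J) k =
      hilbertFunction I k + hilbertFunction J k := by
  have h1 : idealPart (I ⊓ J) k = idealPart I k ⊓ idealPart J k := by
    ext p
    simp only [idealPart, Submodule.mem_inf, Submodule.restrictScalars_mem]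
    tauto
  have h2 : idealPart (I ⊔ J) k = idealPart I k ⊔ idealPart J k := by
    apply le_antisymm
    · rintro p ⟨hp, hp'⟩
      obtain ⟨a, ha, b, hb, rfl⟩ := Submodule.mem_sup.1
        (show p ∈ I ⊔ J from hp')
      rw [← homogeneousComponent_eq_self hp, map_add]
      exact Submodule.add_mem_sup ⟨homogeneousComponent_isHomogeneous _ _, hI a ha k⟩
        ⟨homogeneousComponent_isHomogeneous _ _, hJ b hb k⟩
    · refine sup_le (inf_le_inf le_rfl ?_) (inf_le_inf le_rfl ?_)
      · exact fun x hx => (le_sup_left : I ≤ I ⊔ J) hx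
      · exact fun x hx => (le_sup_right : J ≤ I ⊔ J) hx
  have h3 := Submodule.finrank_sup_add_finrank_inf_eq (idealPart I k) (idealPart J k)
  rw [← h1, ← h2] at h3
  have e1 := hilbertFunction_add_finrank_idealPart (I ⊓ J) k
  have e2 := hilbertFunction_add_finrank_idealPart (I ⊔ J) k
  have e3 := hilbertFunction_add_finrank_idealPart I k
  have e4 := hilbertFunction_add_finrank_idealPart J k
  omega

theorem hilbertSeries_inf_add_sup [Finite σ] {I J : Ideal (MvPolynomial σ K)}
    (hI : IsGradedIdeal I) (hJ : IsGradedIdeal J) :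
    hilbertSeries (I ⊓ J) + hilbertSeries (I ⊔ J) = hilbertSeries I + hilbertSeries J := by
  ext k
  simp only [hilbertSeries, map_add, PowerSeries.coeff_mk]
  exact_mod_cast hilbertFunction_inf_add_sup hI hJ k

/-- A homogeneous retraction does not change the Hilbert series of the quotient. -/
theorem hilbertSeries_comap (φ : MvPolynomial σ K →ₐ[K] MvPolynomial τ K)
    (ψ : MvPolynomial τ K →ₐ[K] MvPolynomial σ K) (h : ∀ p, φ (ψ p) = p)
    (hφ : ∀ p k, p.IsHomogeneous k → (φ p).IsHomogeneous k)
    (hψ : ∀ p k, p.IsHomogeneous k → (ψ p).IsHomogeneous k)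
    (I : Ideal (MvPolynomial τ K)) :
    hilbertSeries (I.comap φ) = hilbertSeries I := by
  ext k
  simp only [hilbertSeries, PowerSeries.coeff_mk, hilbertFunction]
  norm_cast
  let f : (MvPolynomial σ K ⧸ I.comap φ) →ₐ[K] (MvPolynomial τ K ⧸ I) :=
    Ideal.quotientMapₐ I φ le_rfl
  have hf : Function.Injective f := Ideal.quotientMap_injective
  have h1 : (gradedPart (I.comap φ) k).map f.toLinearMap = gradedPart I k := by
    ext r
    simp only [Submodule.mem_map, mem_gradedPart]
    constructor
    · rintro ⟨_, ⟨p, hp, rfl⟩, rfl⟩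
      exact ⟨φ p, hφ p k hp, rfl⟩
    · rintro ⟨p, hp, rfl⟩
      refine ⟨_, ⟨ψ p, hψ p k hp, rfl⟩, ?_⟩
      change Ideal.Quotient.mk I (φ (ψ p)) = _
      rw [h]
  rw [← h1]
  exact (LinearEquiv.finrank_eq (Submodule.equivMapOfInjective f.toLinearMap hf _))

/-- The Hilbert function counts a homogeneous basis. -/
theorem hilbertFunction_eq_card {ι : Type*} {I : Ideal (MvPolynomial σ K)}
    (β : ι → MvPolynomial σ K) (deg : ι → ℕ) (hβ : ∀ i, (β i).IsHomogeneous (deg i))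
    (hli : LinearIndependent K fun i => Ideal.Quotient.mk I (β i)) (k : ℕ)
    (hsp : gradedPart I k ≤
      Submodule.span K ((fun i => Ideal.Quotient.mk I (β i)) '' {i | deg i = k})) :
    hilbertFunction I k = Nat.card {i // deg i = k} := by
  have h1 : gradedPart I k =
      Submodule.span K (Set.range fun i : {i // deg i = k} => Ideal.Quotient.mk I (β i)) := by
    apply le_antisymm
    · convert hsp using 2
      ext x
      simp
    · rw [Submodule.span_le]
      rintro _ ⟨⟨i, rfl⟩, rfl⟩
      exact ⟨β i, hβ i, rfl⟩
  rw [hilbertFunction, h1]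
  have h2 : LinearIndependent K fun i : {i // deg i = k} => Ideal.Quotient.mk I (β i) :=
    hli.comp _ Subtype.val_injective
  exact Module.finrank_eq_nat_card_basis (Module.Basis.span h2)

theorem finite_of_linearIndependent [Finite σ] {ι : Type*} {I : Ideal (MvPolynomial σ K)}
    (β : ι → MvPolynomial σ K) (deg : ι → ℕ) (hβ : ∀ i, (β i).IsHomogeneous (deg i))
    (hli : LinearIndependent K fun i => Ideal.Quotient.mk I (β i)) (k : ℕ) :
    Finite {i // deg i = k} := by
  have h2 : LinearIndependent K fun i : {i // deg i = k} => Ideal.Quotient.mk I (β i) :=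
    hli.comp _ Subtype.val_injective
  let g : {i // deg i = k} → gradedPart I k := fun i =>
    ⟨Ideal.Quotient.mk I (β i), β i, by have h := hβ i.1; rw [i.2] at h; exact h, rfl⟩
  have h3 : LinearIndependent K g := LinearIndependent.of_comp (gradedPart I k).subtype h2
  exact h3.finite

/-- A homogeneous family of polynomials whose classes form a basis of the quotient. -/
theorem exists_homogeneous_basis {I : Ideal (MvPolynomial σ K)} (hI : IsGradedIdeal I) :
    ∃ (s : Set (σ →₀ ℕ)),
      LinearIndependent K (fun i : s => Ideal.Quotient.mk I (monomial i.1 1)) ∧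
      ∀ k, gradedPart I k ≤ Submodule.span K
        ((fun i : s => Ideal.Quotient.mk I (monomial i.1 1)) '' {i | i.1.degree = k}) := by
  -- The classes of all monomials span, so some of them form a basis; staying with monomials keeps
  -- the degree visible.
  obtain ⟨ι, a, ha, hsp, hli⟩ := exists_linearIndependent' K
    (fun m : σ →₀ ℕ => Ideal.Quotient.mk I (monomial m (1 : K)))
  have hr : LinearIndependent K (fun i : Set.range a =>
      Ideal.Quotient.mk I (monomial i.1 (1 : K))) :=
    (linearIndependent_equiv' (Equiv.ofInjective a ha) rfl).1 hli
  refine ⟨Set.range a, hr, fun k r hrk => ?_⟩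
  obtain ⟨p, hp, rfl⟩ := mem_gradedPart.1 hrk
  have htop : Ideal.Quotient.mk I p ∈ Submodule.span K
      (Set.range fun i : Set.range a => Ideal.Quotient.mk I (monomial i.1 (1 : K))) := by
    have e : (Set.range fun i : Set.range a => Ideal.Quotient.mk I (monomial i.1 (1 : K))) =
        Set.range ((fun m : σ →₀ ℕ => Ideal.Quotient.mk I (monomial m (1 : K))) ∘ a) := by
      ext x
      simp
    rw [e, hsp]
    rw [p.as_sum, map_sum]
    refine Submodule.sum_mem _ fun m _ => ?_
    have : monomial m (coeff m p) = coeff m p • monomial m (1 : K) := by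
      simp [smul_monomial]
    rw [this]
    exact Submodule.smul_mem _ (coeff m p) (Submodule.subset_span (Set.mem_range_self m))
  obtain ⟨c, hc⟩ := Finsupp.mem_span_range_iff_exists_finsupp.1 htop
  -- The expansion of `p` may involve basis monomials of every degree. Since `I` is graded, the
  -- degree `k` component of this relation is again a relation, and it keeps only those of degree
  -- `k`.
  have hmem : (c.sum fun i b => b • monomial i.1 (1 : K)) - p ∈ I := by
    rw [← Ideal.Quotient.eq, ← hc, Finsupp.sum, map_sum]
    rfl
  have hmem' := hI _ hmem k
  rw [map_sub, homogeneousComponent_eq_self hp, ← Ideal.Quotient.eq, Finsupp.sum, map_sum,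
    map_sum] at hmem'
  rw [← hmem']
  refine Submodule.sum_mem _ fun i _ => ?_
  by_cases hi : i.1.degree = k
  · have : homogeneousComponent k (c i • monomial i.1 (1 : K)) = c i • monomial i.1 (1 : K) := by
      rw [map_smul, homogeneousComponent_eq_self (isHomogeneous_monomial _ hi)]
    rw [this]
    have hmem : Ideal.Quotient.mk I (monomial i.1 (1 : K)) ∈ Submodule.span K
        ((fun i : Set.range a => Ideal.Quotient.mk I (monomial i.1 (1 : K))) ''
          {i | i.1.degree = k}) := Submodule.subset_span ⟨i, hi, rfl⟩
    exact Submodule.smul_mem _ (c i) hmem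
  · have : homogeneousComponent k (c i • monomial i.1 (1 : K)) = 0 := by
      rw [map_smul, homogeneousComponent_of_mem
        ((mem_homogeneousSubmodule _ _).2 (isHomogeneous_monomial _ rfl)),
        if_neg (Ne.symm hi), smul_zero]
    rw [this, map_zero]
    exact Submodule.zero_mem _

end HilbertFunction

end BinomialEdge

namespace BinomialEdge

open MvPolynomial

/-! ### Multiplicativity for disjoint sets of variables -/

section Product

open scoped TensorProduct

variable {σ K : Type*} [Field K]

/-- The endomorphism that keeps the variables in `s` and sends the other ones to zero. -/
noncomputable def retract (K : Type*) [Field K] (s : Set σ) :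
    MvPolynomial σ K →ₐ[K] MvPolynomial σ K :=
  open Classical in aeval fun i => if i ∈ s then X i else 0

theorem retract_X_of_mem {s : Set σ} {i : σ} (h : i ∈ s) : retract K s (X i) = X i := by
  simp [retract, h]

theorem retract_X_of_notMem {s : Set σ} {i : σ} (h : i ∉ s) : retract K s (X i) = 0 := by
  simp [retract, h]

theorem isHomogeneous_retract (s : Set σ) {p : MvPolynomial σ K} {k : ℕ}
    (h : p.IsHomogeneous k) : (retract K s p).IsHomogeneous k := by
  classical
  have := h.aeval (fun i => if i ∈ s then (X i : MvPolynomial σ K) else 0) (n := 1) (fun i => by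
    split_ifs
    · exact isHomogeneous_X _ _
    · exact isHomogeneous_zero _ _ _)
  rw [one_mul] at this
  exact this

theorem algHom_monomial {A : Type*} [CommRing A] [Algebra K A] (f : MvPolynomial σ K →ₐ[K] A)
    (m : σ →₀ ℕ) : f (monomial m 1) = m.prod fun i k => f (X i) ^ k := by
  rw [monomial_eq, C_1, one_mul, Finsupp.prod, map_prod]
  simp [Finsupp.prod]

theorem retract_monomial (s : Set σ) {m : σ →₀ ℕ} (h : ∀ i ∈ m.support, i ∈ s) :
    retract K s (monomial m 1) = monomial m 1 := by
  rw [algHom_monomial, monomial_eq, C_1, one_mul]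
  exact Finsupp.prod_congr fun i hi => by rw [retract_X_of_mem (h i hi)]

/-- The Cauchy product at the level of graded bases. -/
theorem card_prod_eq_sum {ι κ : Type*} (d : ι → ℕ) (e : κ → ℕ)
    [∀ k, Finite {i // d i = k}] [∀ k, Finite {j // e j = k}] (k : ℕ) :
    Nat.card {x : ι × κ // d x.1 + e x.2 = k} =
      ∑ p ∈ Finset.HasAntidiagonal.antidiagonal k, Nat.card {i // d i = p.1} * Nat.card {j // e j = p.2} := by
  let E : {x : ι × κ // d x.1 + e x.2 = k} ≃
      Σ p : Finset.HasAntidiagonal.antidiagonal k, {i // d i = p.1.1} × {j // e j = p.1.2} :=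
    { toFun := fun x => ⟨⟨(d x.1.1, e x.1.2), Finset.HasAntidiagonal.mem_antidiagonal.2 x.2⟩,
        ⟨x.1.1, rfl⟩, ⟨x.1.2, rfl⟩⟩
      invFun := fun y => ⟨(y.2.1.1, y.2.2.1), by
        rw [y.2.1.2, y.2.2.2]; exact Finset.HasAntidiagonal.mem_antidiagonal.1 y.1.2⟩
      left_inv := fun x => rfl
      right_inv := by
        rintro ⟨⟨⟨p, q⟩, h⟩, ⟨i, hi⟩, ⟨j, hj⟩⟩
        dsimp only at hi hj
        subst hi hj
        rfl }
  rw [Nat.card_congr E, Nat.card_sigma]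
  simp only [Nat.card_prod]
  exact Finset.sum_coe_sort (Finset.HasAntidiagonal.antidiagonal k)
    (fun p => Nat.card {i // d i = p.1} * Nat.card {j // e j = p.2})

theorem linearIndependent_of_map_eq_tmul {A B C ι κ : Type*} [CommRing A] [CommRing B] [CommRing C]
    [Algebra K A] [Algebra K B] [Algebra K C] (f : C →ₐ[K] A ⊗[K] B) (u : ι × κ → C) {v : ι → A}
    {w : κ → B} (h : ∀ x, f (u x) = v x.1 ⊗ₜ w x.2) (hv : LinearIndependent K v)
    (hw : LinearIndependent K w) : LinearIndependent K u := by
  apply LinearIndependent.of_comp f.toLinearMap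
  have : f.toLinearMap ∘ u = fun x => v x.1 ⊗ₜ w x.2 := funext h
  rw [this]
  exact hv.tmul_of_isDomain hw

/-- If the polynomial ring is divided by ideals in complementary sets of variables, the Hilbert
series are multiplied. In `I₁` and `I₂` the variables of the other set are included. -/
theorem hilbertSeries_eq_mul [Finite σ] (s : Set σ) {I I₁ I₂ : Ideal (MvPolynomial σ K)}
    (g₁ : IsGradedIdeal I₁) (g₂ : IsGradedIdeal I₂)
    (h₁ : ∀ i, i ∉ s → X i ∈ I₁) (h₂ : ∀ i ∈ s, X i ∈ I₂)
    (r₁ : ∀ p ∈ I₁, retract K s p ∈ I) (r₂ : ∀ p ∈ I₂, retract K sᶜ p ∈ I)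
    (Φ : MvPolynomial σ K →ₐ[K] (MvPolynomial σ K ⧸ I₁) ⊗[K] (MvPolynomial σ K ⧸ I₂))
    (hΦ₁ : ∀ i ∈ s, Φ (X i) = Ideal.Quotient.mk I₁ (X i) ⊗ₜ 1)
    (hΦ₂ : ∀ i ∉ s, Φ (X i) = 1 ⊗ₜ Ideal.Quotient.mk I₂ (X i))
    (hΦ : ∀ p ∈ I, Φ p = 0) :
    hilbertSeries I = hilbertSeries I₁ * hilbertSeries I₂ := by
  obtain ⟨b₁, l₁, sp₁⟩ := exists_homogeneous_basis g₁
  obtain ⟨b₂, l₂, sp₂⟩ := exists_homogeneous_basis g₂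
  have c₁ : ∀ p, Φ (retract K s p) = Ideal.Quotient.mk I₁ p ⊗ₜ 1 := by
    have : Φ.comp (retract K s) =
        (Algebra.TensorProduct.includeLeft : _ →ₐ[K] _).comp (Ideal.Quotient.mkₐ K I₁) := by
      apply MvPolynomial.algHom_ext
      intro i
      by_cases hi : i ∈ s
      · simp [retract_X_of_mem hi, hΦ₁ i hi]
      · simp [retract_X_of_notMem hi, Ideal.Quotient.eq_zero_iff_mem.2 (h₁ i hi)]
    exact fun p => DFunLike.congr_fun this p
  have c₂ : ∀ p, Φ (retract K sᶜ p) = 1 ⊗ₜ Ideal.Quotient.mk I₂ p := by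
    have : Φ.comp (retract K sᶜ) =
        (Algebra.TensorProduct.includeRight : _ →ₐ[K] _).comp (Ideal.Quotient.mkₐ K I₂) := by
      apply MvPolynomial.algHom_ext
      intro i
      by_cases hi : i ∈ s
      · simp [retract_X_of_notMem (s := sᶜ) (not_not.2 hi),
          Ideal.Quotient.eq_zero_iff_mem.2 (h₂ i hi)]
      · simp [retract_X_of_mem (s := sᶜ) hi, hΦ₂ i hi]
    exact fun p => DFunLike.congr_fun this p
  -- Products of the two monomial bases, each retracted to its own variables, will be a basis of `S
  -- ⧸ I`: `Φ` sends them to pure tensors of basis elements, which gives independence.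
  let β : b₁ × b₂ → MvPolynomial σ K := fun x =>
    retract K s (monomial x.1.1 1) * retract K sᶜ (monomial x.2.1 1)
  have hβ : ∀ x, (β x).IsHomogeneous (x.1.1.degree + x.2.1.degree) := fun x =>
    (isHomogeneous_retract _ (isHomogeneous_monomial _ rfl)).mul
      (isHomogeneous_retract _ (isHomogeneous_monomial _ rfl))
  have hΦβ : ∀ x, Φ (β x) =
      Ideal.Quotient.mk I₁ (monomial x.1.1 1) ⊗ₜ Ideal.Quotient.mk I₂ (monomial x.2.1 1) := by
    intro x
    simp only [β, map_mul, c₁, c₂, Algebra.TensorProduct.tmul_mul_tmul, one_mul, mul_one]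
  have hli : LinearIndependent K fun x => Ideal.Quotient.mk I (β x) := by
    exact linearIndependent_of_map_eq_tmul (Ideal.Quotient.liftₐ I Φ hΦ) _
      (v := fun i : b₁ => Ideal.Quotient.mk I₁ (monomial i.1 1))
      (w := fun i : b₂ => Ideal.Quotient.mk I₂ (monomial i.1 1)) (fun x => hΦβ x) l₁ l₂
  -- Since the retraction carries `J` into `I`, it induces a map `S ⧸ J → S ⧸ I`. This map
  -- transports the spanning monomials and fixes the class of a monomial in the variables of `t`.
  have θ : ∀ (t : Set σ) (J : Ideal (MvPolynomial σ K)), (∀ p ∈ J, retract K t p ∈ I) →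
      ∀ (b : Set (σ →₀ ℕ)), (∀ k, gradedPart J k ≤ Submodule.span K
        ((fun i : b => Ideal.Quotient.mk J (monomial i.1 1)) '' {i | i.1.degree = k})) →
      ∀ m : σ →₀ ℕ, (∀ i ∈ m.support, i ∈ t) →
      Ideal.Quotient.mk I (monomial m 1) ∈ Submodule.span K
        ((fun i : b => Ideal.Quotient.mk I (retract K t (monomial i.1 1))) ''
          {i | i.1.degree = m.degree}) := by
    intro t J hJ b hb m hm
    let f : (MvPolynomial σ K ⧸ J) →ₐ[K] (MvPolynomial σ K ⧸ I) :=
      Ideal.Quotient.liftₐ J ((Ideal.Quotient.mkₐ K I).comp (retract K t))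
        (fun p hp => Ideal.Quotient.eq_zero_iff_mem.2 (hJ p hp))
    have h := Submodule.mem_map_of_mem (f := f.toLinearMap)
      (hb m.degree ⟨monomial m 1, isHomogeneous_monomial _ rfl, rfl⟩)
    rw [Submodule.map_span, ← Set.image_comp] at h
    have e : f.toLinearMap ((Ideal.Quotient.mkₐ K J).toLinearMap (monomial m 1)) =
        Ideal.Quotient.mk I (monomial m 1) := by
      change Ideal.Quotient.mk I (retract K t (monomial m 1)) = _
      rw [retract_monomial t hm]
    rw [e] at h
    exact h
  have hsp : ∀ k, gradedPart I k ≤ Submodule.span K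
      ((fun x => Ideal.Quotient.mk I (β x)) '' {x | x.1.1.degree + x.2.1.degree = k}) := by
    classical
    rintro k r hr
    obtain ⟨p, hp, rfl⟩ := mem_gradedPart.1 hr
    rw [p.as_sum, map_sum]
    refine Submodule.sum_mem _ fun m hm => ?_
    have hmk : m.degree = k := by
      by_contra hne
      exact (mem_support_iff.1 hm) (hp.coeff_eq_zero hne)
    have e1 : monomial m (coeff m p) = coeff m p • monomial m (1 : K) := by
      simp [smul_monomial]
    have key : Ideal.Quotient.mk I (monomial m (1 : K)) ∈ Submodule.span K
      ((fun x => Ideal.Quotient.mk I (β x)) '' {x | x.1.1.degree + x.2.1.degree = k}) := by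
      have e2 : m.filter (· ∈ s) + m.filter (fun i => ¬ i ∈ s) = m :=
        Finsupp.filter_add_filter_not m _
      have e3 : monomial m (1 : K) =
          monomial (m.filter (· ∈ s)) 1 * monomial (m.filter fun i => ¬ i ∈ s) 1 := by
        rw [monomial_mul, e2, one_mul]
      rw [e3, map_mul]
      have t1 := θ s I₁ r₁ b₁ sp₁ (m.filter (· ∈ s)) (by simp [Finsupp.support_filter])
      have t2 := θ sᶜ I₂ r₂ b₂ sp₂ (m.filter fun i => ¬ i ∈ s) (by simp [Finsupp.support_filter])
      have t3 := Submodule.mul_mem_mul t1 t2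
      rw [Submodule.span_mul_span] at t3
      refine Submodule.span_mono ?_ t3
      rintro _ ⟨_, ⟨x, hx, rfl⟩, _, ⟨y, hy, rfl⟩, rfl⟩
      refine ⟨(x, y), ?_, ?_⟩
      · change x.1.degree + y.1.degree = k
        rw [hx, hy, ← map_add, e2, hmk]
      · simp [β]
    rw [e1]
    exact Submodule.smul_mem _ (coeff m p) key
  ext k
  simp only [hilbertSeries, PowerSeries.coeff_mul, PowerSeries.coeff_mk]
  have hf₁ : ∀ k, hilbertFunction I₁ k = Nat.card {i : b₁ // i.1.degree = k} := fun k =>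
    hilbertFunction_eq_card _ (fun i : b₁ => i.1.degree)
      (fun i => isHomogeneous_monomial _ rfl) l₁ k (sp₁ k)
  have hf₂ : ∀ k, hilbertFunction I₂ k = Nat.card {i : b₂ // i.1.degree = k} := fun k =>
    hilbertFunction_eq_card _ (fun i : b₂ => i.1.degree)
      (fun i => isHomogeneous_monomial _ rfl) l₂ k (sp₂ k)
  have f₁ : ∀ k, Finite {i : b₁ // i.1.degree = k} := fun k =>
    finite_of_linearIndependent _ (fun i : b₁ => i.1.degree)
      (fun i => isHomogeneous_monomial _ rfl) l₁ k
  have f₂ : ∀ k, Finite {i : b₂ // i.1.degree = k} := fun k =>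
    finite_of_linearIndependent _ (fun i : b₂ => i.1.degree)
      (fun i => isHomogeneous_monomial _ rfl) l₂ k
  rw [hilbertFunction_eq_card β (fun x => x.1.1.degree + x.2.1.degree) hβ hli k (hsp k),
    card_prod_eq_sum (fun i : b₁ => i.1.degree) (fun i : b₂ => i.1.degree)]
  push_cast
  simp only [hf₁, hf₂]

end Product

end BinomialEdge

namespace BinomialEdge

open MvPolynomial

/-! ### Ideals of induced subgraphs and Ohtani's decomposition -/

section InducedIdeal

variable {V : Type*} (K : Type*) [Field K]

/-- The binomial `x_i y_j - x_j y_i`. -/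
noncomputable def edgeBinomial (i j : V) : MvPolynomial (V ⊕ V) K :=
  X (Sum.inl i) * X (Sum.inr j) - X (Sum.inl j) * X (Sum.inr i)

/-- The variables of the vertices in `D`. -/
def varSet (D : Set V) : Set (V ⊕ V) := {s | Sum.elim id id s ∈ D}

@[simp] theorem inl_mem_varSet {D : Set V} {i : V} : Sum.inl i ∈ varSet D ↔ i ∈ D := Iff.rfl

@[simp] theorem inr_mem_varSet {D : Set V} {i : V} : Sum.inr i ∈ varSet D ↔ i ∈ D := Iff.rfl

/-- The ideal generated by the edge binomials of `G` and by the variables of the vertices outside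
`D`. The quotient by it is that of the binomial edge ideal of the induced graph `G[D]`. -/
noncomputable def inducedIdeal (G : SimpleGraph V) (D : Set V) : Ideal (MvPolynomial (V ⊕ V) K) :=
  Ideal.span ({f | ∃ i j, G.Adj i j ∧ f = edgeBinomial K i j} ∪ {f | ∃ s, s ∉ varSet D ∧ f = X s})

variable {K} {G G' : SimpleGraph V} {D D' : Set V}

theorem edgeBinomial_mem {i j : V} (h : G.Adj i j) : edgeBinomial K i j ∈ inducedIdeal K G D :=
  Ideal.subset_span (Or.inl ⟨i, j, h, rfl⟩)

theorem X_mem {s : V ⊕ V} (h : s ∉ varSet D) : X s ∈ inducedIdeal K G D :=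
  Ideal.subset_span (Or.inr ⟨s, h, rfl⟩)

theorem inducedIdeal_le {I : Ideal (MvPolynomial (V ⊕ V) K)}
    (h₁ : ∀ i j, G.Adj i j → edgeBinomial K i j ∈ I) (h₂ : ∀ s, s ∉ varSet D → X s ∈ I) :
    inducedIdeal K G D ≤ I := by
  rw [inducedIdeal, Ideal.span_le]
  rintro _ (⟨i, j, h, rfl⟩ | ⟨s, hs, rfl⟩)
  · exact h₁ i j h
  · exact h₂ s hs

theorem inducedIdeal_univ : inducedIdeal K G Set.univ = binomialEdgeIdeal K G := by
  apply le_antisymm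
  · refine inducedIdeal_le (fun i j h => Ideal.subset_span ⟨i, j, h, rfl⟩) ?_
    rintro (s | s) h <;> exact absurd trivial h
  · refine Ideal.span_le.2 ?_
    rintro _ ⟨i, j, h, rfl⟩
    exact edgeBinomial_mem h

theorem isHomogeneous_edgeBinomial (i j : V) : (edgeBinomial K i j).IsHomogeneous 2 :=
  ((isHomogeneous_X _ _).mul (isHomogeneous_X _ _)).sub
    ((isHomogeneous_X _ _).mul (isHomogeneous_X _ _))

theorem isGradedIdeal_inducedIdeal : IsGradedIdeal (inducedIdeal K G D) := by
  apply isGradedIdeal_span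
  rintro _ (⟨i, j, h, rfl⟩ | ⟨s, hs, rfl⟩)
  · exact ⟨2, isHomogeneous_edgeBinomial i j⟩
  · exact ⟨1, isHomogeneous_X _ _⟩

/-- Only the edges between vertices of `D` matter. -/
theorem edgeBinomial_mem_of_adj {i j : V} (h : i ∈ D → j ∈ D → G.Adj i j) :
    edgeBinomial K i j ∈ inducedIdeal K G D := by
  by_cases hi : i ∈ D
  · by_cases hj : j ∈ D
    · exact edgeBinomial_mem (h hi hj)
    · exact sub_mem (Ideal.mul_mem_left _ _ (X_mem hj)) (Ideal.mul_mem_right _ _ (X_mem hj))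
  · exact sub_mem (Ideal.mul_mem_right _ _ (X_mem hi)) (Ideal.mul_mem_left _ _ (X_mem hi))

theorem inducedIdeal_mono (h : ∀ i ∈ D', ∀ j ∈ D', G.Adj i j → G'.Adj i j) (hD : D' ⊆ D) :
    inducedIdeal K G D ≤ inducedIdeal K G' D' :=
  inducedIdeal_le (fun i j hij => edgeBinomial_mem_of_adj fun hi hj => h i hi j hj hij)
    (fun _ hs => X_mem fun hs' => hs (hD hs'))

theorem inducedIdeal_congr (h : ∀ i ∈ D, ∀ j ∈ D, G.Adj i j ↔ G'.Adj i j) :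
    inducedIdeal K G D = inducedIdeal K G' D :=
  le_antisymm (inducedIdeal_mono (fun i hi j hj => (h i hi j hj).1) le_rfl)
    (inducedIdeal_mono (fun i hi j hj => (h i hi j hj).2) le_rfl)

/-- The graph in which the neighbours of `u` are made pairwise adjacent. -/
def completeAt (G : SimpleGraph V) (u : V) : SimpleGraph V where
  Adj i j := G.Adj i j ∨ (i ≠ j ∧ G.Adj u i ∧ G.Adj u j)
  symm := ⟨by
    rintro i j (h | ⟨h, h1, h2⟩)
    · exact Or.inl h.symm
    · exact Or.inr ⟨h.symm, h2, h1⟩⟩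
  loopless := ⟨by
    rintro i (h | ⟨h, -⟩)
    · exact G.loopless.irrefl i h
    · exact h rfl⟩

theorem completeAt_adj {u i j : V} :
    (completeAt G u).Adj i j ↔ G.Adj i j ∨ (i ≠ j ∧ G.Adj u i ∧ G.Adj u j) := Iff.rfl

theorem retract_edgeBinomial {i j : V} (hi : i ∈ D) (hj : j ∈ D) :
    retract K (varSet D) (edgeBinomial K i j) = edgeBinomial K i j := by
  have h1 : ∀ k ∈ D, Sum.inl k ∈ varSet D := fun k hk => hk
  have h2 : ∀ k ∈ D, Sum.inr k ∈ varSet D := fun k hk => hk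
  simp only [edgeBinomial, map_sub, map_mul, retract_X_of_mem (h1 _ hi),
    retract_X_of_mem (h2 _ hi), retract_X_of_mem (h1 _ hj), retract_X_of_mem (h2 _ hj)]

theorem retract_edgeBinomial_eq_zero {i j : V} (h : i ∉ D ∨ j ∉ D) :
    retract K (varSet D) (edgeBinomial K i j) = 0 := by
  have h1 : ∀ k, k ∉ D → Sum.inl k ∉ varSet D := fun k hk => hk
  have h2 : ∀ k, k ∉ D → Sum.inr k ∉ varSet D := fun k hk => hk
  rcases h with h | h <;>
  simp [edgeBinomial, retract_X_of_notMem (h1 _ h), retract_X_of_notMem (h2 _ h)]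

/-- It suffices to look at generators: the retraction fixes a binomial with both ends in `E` and
kills every other one. -/
theorem retract_mem {I : Ideal (MvPolynomial (V ⊕ V) K)} {E : Set V}
    (h₁ : ∀ i ∈ E, ∀ j ∈ E, G.Adj i j → edgeBinomial K i j ∈ I)
    (h₂ : ∀ s ∈ varSet E, s ∉ varSet D → X s ∈ I) :
    ∀ p ∈ inducedIdeal K G D, retract K (varSet E) p ∈ I := by
  have : inducedIdeal K G D ≤ I.comap (retract K (varSet E)) := by
    refine inducedIdeal_le (fun i j h => ?_) (fun s hs => ?_)
    · rw [Ideal.mem_comap]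
      by_cases hi : i ∈ E
      · by_cases hj : j ∈ E
        · rw [retract_edgeBinomial hi hj]
          exact h₁ i hi j hj h
        · rw [retract_edgeBinomial_eq_zero (Or.inr hj)]
          exact zero_mem _
      · rw [retract_edgeBinomial_eq_zero (Or.inl hi)]
        exact zero_mem _
    · rw [Ideal.mem_comap]
      by_cases hsE : s ∈ varSet E
      · rw [retract_X_of_mem hsE]
        exact h₂ s hsE hs
      · rw [retract_X_of_notMem hsE]
        exact zero_mem _
  exact fun p hp => this hp

/-- Modulo the variables outside `s`, the identity and the retraction are algebra maps that agree on
all variables. -/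
theorem sub_retract_mem (s : Set (V ⊕ V)) (p : MvPolynomial (V ⊕ V) K) :
    p - retract K s p ∈ Ideal.span {f | ∃ t, t ∉ s ∧ f = (X t : MvPolynomial (V ⊕ V) K)} := by
  have : (Ideal.Quotient.mkₐ K (Ideal.span {f | ∃ t, t ∉ s ∧ f = (X t : MvPolynomial (V ⊕ V) K)})) =
      (Ideal.Quotient.mkₐ K _).comp (retract K s) := by
    apply MvPolynomial.algHom_ext
    intro i
    by_cases hi : i ∈ s
    · simp [retract_X_of_mem hi]
    · simp only [AlgHom.comp_apply, retract_X_of_notMem hi, map_zero]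
      exact Ideal.Quotient.eq_zero_iff_mem.2 (Ideal.subset_span ⟨i, hi, rfl⟩)
  exact Ideal.Quotient.eq.1 (DFunLike.congr_fun this p)

theorem inducedIdeal_completeAt_sup {u : V} :
    inducedIdeal K (completeAt G u) D ⊔ inducedIdeal K G (D \ {u}) =
      inducedIdeal K (completeAt G u) (D \ {u}) := by
  apply le_antisymm
  · exact sup_le (inducedIdeal_mono (fun _ _ _ _ h => h) Set.sdiff_subset)
      (inducedIdeal_mono (fun _ _ _ _ h => Or.inl h) le_rfl)
  · exact inducedIdeal_le (fun i j h => Ideal.mem_sup_left (edgeBinomial_mem h))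
      (fun s hs => Ideal.mem_sup_right (X_mem hs))

/-- Ohtani's decomposition of a binomial edge ideal at a vertex. -/
theorem inducedIdeal_completeAt_inf {u : V} :
    inducedIdeal K (completeAt G u) D ⊓ inducedIdeal K G (D \ {u}) = inducedIdeal K G D := by
  apply le_antisymm
  swap
  · exact le_inf (inducedIdeal_mono (fun _ _ _ _ h => Or.inl h) le_rfl)
      (inducedIdeal_mono (fun _ _ _ _ h => h) Set.sdiff_subset)
  rintro h ⟨h₁, h₂⟩
  set E : Ideal (MvPolynomial (V ⊕ V) K) :=
    Ideal.span {f | ∃ i j, G.Adj u i ∧ G.Adj u j ∧ f = edgeBinomial K i j} with hE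
  -- Modulo the ideal of `G[D]`, an element of the first ideal may be replaced by some `e ∈ E`, a
  -- combination of binomials of pairs of neighbours of `u`.
  have hle : inducedIdeal K (completeAt G u) D ≤ inducedIdeal K G D ⊔ E := by
    refine inducedIdeal_le ?_ (fun s hs => Ideal.mem_sup_left (X_mem hs))
    rintro i j (h | ⟨-, h1, h2⟩)
    · exact Ideal.mem_sup_left (edgeBinomial_mem h)
    · exact Ideal.mem_sup_right (Ideal.subset_span ⟨i, j, h1, h2, rfl⟩)
  obtain ⟨g, hg, e, he, rfl⟩ := Submodule.mem_sup.1 (hle h₁)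
  refine add_mem hg ?_
  have he₂ : e ∈ inducedIdeal K G (D \ {u}) := by
    have := sub_mem h₂ ((inducedIdeal_mono (fun _ _ _ _ h => h) Set.sdiff_subset :
      inducedIdeal K G D ≤ inducedIdeal K G (D \ {u})) hg)
    rwa [add_sub_cancel_left] at this
  set s : Set (V ⊕ V) := varSet {u}ᶜ with hs
  -- Setting the variables of `u` to zero removes the only generators of the second ideal that might
  -- be missing from the ideal of `G[D]`.
  have c₁ : retract K s e ∈ inducedIdeal K G D := by
    refine retract_mem (E := {u}ᶜ) (fun i _ j _ hij => edgeBinomial_mem hij) ?_ e he₂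
    rintro (t | t) ht ht' <;>
    exact X_mem fun hm => ht' ⟨hm, ht⟩
  -- With `f_ij` the binomial of `i, j`, the identity `x_u f_ij = x_i f_uj - x_j f_ui` and its
  -- analogue for `y_u` show that the variables of `u` multiply `E` into the ideal of `G[D]`.
  have c₂ : ∀ a ∈ Ideal.span {f | ∃ t, t ∉ s ∧ f = (X t : MvPolynomial (V ⊕ V) K)}, ∀ b ∈ E,
      a * b ∈ inducedIdeal K G D := by
    intro a ha b hb
    have := Ideal.mul_mem_mul ha hb
    rw [hE, Ideal.span_mul_span'] at this
    refine (Ideal.span_le.2 ?_) this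
    rintro _ ⟨_, ⟨t, ht, rfl⟩, _, ⟨i, j, hi, hj, rfl⟩, rfl⟩
    have mi := edgeBinomial_mem (K := K) (D := D) hi
    have mj := edgeBinomial_mem (K := K) (D := D) hj
    rcases t with t | t
    · obtain rfl : t = u := by simpa [hs] using ht
      have : X (Sum.inl t) * edgeBinomial K i j =
          X (Sum.inl i) * edgeBinomial K t j - X (Sum.inl j) * edgeBinomial K t i := by
        simp only [edgeBinomial]
        ring
      change X (Sum.inl t) * edgeBinomial K i j ∈ inducedIdeal K G D
      rw [this]
      exact sub_mem (Ideal.mul_mem_left _ _ mj) (Ideal.mul_mem_left _ _ mi)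
    · obtain rfl : t = u := by simpa [hs] using ht
      have : X (Sum.inr t) * edgeBinomial K i j =
          X (Sum.inr i) * edgeBinomial K t j - X (Sum.inr j) * edgeBinomial K t i := by
        simp only [edgeBinomial]
        ring
      change X (Sum.inr t) * edgeBinomial K i j ∈ inducedIdeal K G D
      rw [this]
      exact sub_mem (Ideal.mul_mem_left _ _ mj) (Ideal.mul_mem_left _ _ mi)
  -- The generators of `E` do not involve `u`, so retraction changes only their coefficients, by
  -- multiples of the variables of `u`; `c₂` absorbs the difference.
  have c₃ : ∀ b ∈ E, b - retract K s b ∈ inducedIdeal K G D := by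
    intro b hb
    rw [hE] at hb
    induction hb using Submodule.span_induction with
    | mem x hx =>
      obtain ⟨i, j, hi, hj, rfl⟩ := hx
      rw [hs, retract_edgeBinomial (D := {u}ᶜ) hi.ne' hj.ne', sub_self]
      exact zero_mem _
    | zero => simp
    | add x y hx hy hx' hy' =>
      rw [map_add, add_sub_add_comm]
      exact add_mem hx' hy'
    | smul a x hx hx' =>
      have : a • x - retract K s (a • x) =
          (a - retract K s a) * x + retract K s a * (x - retract K s x) := by
        rw [smul_eq_mul, map_mul]
        ring
      rw [this]
      exact add_mem (c₂ _ (sub_retract_mem s a) x hx) (Ideal.mul_mem_left _ _ hx')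
  have := add_mem (c₃ e he) c₁
  rwa [sub_add_cancel] at this

theorem hilbertSeries_completeAt [Finite V] (G : SimpleGraph V) (D : Set V) (u : V) :
    hilbertSeries (inducedIdeal K G D) +
        hilbertSeries (inducedIdeal K (completeAt G u) (D \ {u})) =
      hilbertSeries (inducedIdeal K (completeAt G u) D) +
        hilbertSeries (inducedIdeal K G (D \ {u})) := by
  rw [← inducedIdeal_completeAt_inf (u := u), ← inducedIdeal_completeAt_sup]
  exact hilbertSeries_inf_add_sup isGradedIdeal_inducedIdeal isGradedIdeal_inducedIdeal

/-- The Hilbert series of the binomial edge ideal of an induced graph. -/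
theorem hilbertSeries_binomialEdgeIdeal_induce (F : SimpleGraph D)
    (hF : ∀ a b : D, F.Adj a b ↔ G.Adj a b) :
    hilbertSeries (binomialEdgeIdeal K F) = hilbertSeries (inducedIdeal K G D) := by
  classical
  let ψ : MvPolynomial (D ⊕ D) K →ₐ[K] MvPolynomial (V ⊕ V) K :=
    aeval (Sum.elim (fun a => X (Sum.inl a.1)) (fun a => X (Sum.inr a.1)))
  let φ : MvPolynomial (V ⊕ V) K →ₐ[K] MvPolynomial (D ⊕ D) K :=
    aeval (Sum.elim (fun a => if h : a ∈ D then X (Sum.inl ⟨a, h⟩) else 0)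
      (fun a => if h : a ∈ D then X (Sum.inr ⟨a, h⟩) else 0))
  have φ₁ : ∀ a : D, φ (X (Sum.inl a.1)) = X (Sum.inl a) := fun a => by simp [φ]
  have φ₂ : ∀ a : D, φ (X (Sum.inr a.1)) = X (Sum.inr a) := fun a => by simp [φ]
  have φ₀ : ∀ s, s ∉ varSet D → φ (X s) = 0 := by
    rintro (s | s) hs
    · rw [inl_mem_varSet] at hs
      simp [φ, hs]
    · rw [inr_mem_varSet] at hs
      simp [φ, hs]
  have ψ₁ : ∀ a : D, ψ (X (Sum.inl a)) = X (Sum.inl a.1) := fun a => by simp [ψ]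
  have ψ₂ : ∀ a : D, ψ (X (Sum.inr a)) = X (Sum.inr a.1) := fun a => by simp [ψ]
  have h₁ : φ.comp ψ = AlgHom.id K _ := by
    apply MvPolynomial.algHom_ext
    rintro (a | a)
    · rw [AlgHom.comp_apply, ψ₁, φ₁]
      rfl
    · rw [AlgHom.comp_apply, ψ₂, φ₂]
      rfl
  have h₂ : ψ.comp φ = retract K (varSet D) := by
    apply MvPolynomial.algHom_ext
    intro s
    by_cases hs : s ∈ varSet D
    · rw [retract_X_of_mem hs, AlgHom.comp_apply]
      rcases s with s | s
      · rw [φ₁ ⟨s, hs⟩, ψ₁]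
      · rw [φ₂ ⟨s, hs⟩, ψ₂]
    · rw [retract_X_of_notMem hs, AlgHom.comp_apply, φ₀ s hs, map_zero]
  -- A polynomial differs from its retraction `ψ (φ p)` only by multiples of the variables outside
  -- `D`, which belong to the right-hand ideal.
  have h₃ : (binomialEdgeIdeal K F).comap φ = inducedIdeal K G D := by
    apply le_antisymm
    · intro p hp
      have e₁ : retract K (varSet D) p ∈ inducedIdeal K G D := by
        rw [← h₂, AlgHom.comp_apply]
        have : binomialEdgeIdeal K F ≤ (inducedIdeal K G D).comap ψ := by
          refine Ideal.span_le.2 ?_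
          rintro _ ⟨i, j, hij, rfl⟩
          change ψ _ ∈ inducedIdeal K G D
          rw [map_sub, map_mul, map_mul, ψ₁, ψ₁, ψ₂, ψ₂]
          exact edgeBinomial_mem ((hF i j).1 hij)
        exact this hp
      have e₂ : p - retract K (varSet D) p ∈ inducedIdeal K G D := by
        refine (Ideal.span_le.2 ?_) (sub_retract_mem (varSet D) p)
        rintro _ ⟨t, ht, rfl⟩
        exact X_mem ht
      have := add_mem e₂ e₁
      rwa [sub_add_cancel] at this
    · refine inducedIdeal_le (fun i j hij => ?_) (fun s hs => ?_)
      · rw [Ideal.mem_comap, edgeBinomial, map_sub, map_mul, map_mul]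
        by_cases hi : i ∈ D
        · by_cases hj : j ∈ D
          · rw [φ₁ ⟨i, hi⟩, φ₁ ⟨j, hj⟩, φ₂ ⟨i, hi⟩, φ₂ ⟨j, hj⟩]
            exact Ideal.subset_span ⟨⟨i, hi⟩, ⟨j, hj⟩, (hF _ _).2 hij, rfl⟩
          · rw [φ₀ (Sum.inl j) hj, φ₀ (Sum.inr j) hj]
            simp
        · rw [φ₀ (Sum.inl i) hi, φ₀ (Sum.inr i) hi]
          simp
      · rw [Ideal.mem_comap, φ₀ s hs]
        exact zero_mem _
  rw [← h₃]
  refine (hilbertSeries_comap φ ψ (fun p => DFunLike.congr_fun h₁ p) ?_ ?_ _).symm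
  · intro p k hp
    have := hp.aeval (Sum.elim (fun a => if h : a ∈ D then X (Sum.inl ⟨a, h⟩) else 0)
      (fun a => if h : a ∈ D then (X (Sum.inr ⟨a, h⟩) : MvPolynomial (D ⊕ D) K) else 0))
      (n := 1) (by
        rintro (a | a) <;> simp only [Sum.elim_inl, Sum.elim_inr] <;> split_ifs <;>
        first | exact isHomogeneous_X _ _ | exact isHomogeneous_zero _ _ _)
    rw [one_mul] at this
    exact this
  · intro p k hp
    have := hp.aeval (Sum.elim (fun a : D => X (Sum.inl a.1))
      (fun a : D => (X (Sum.inr a.1) : MvPolynomial (V ⊕ V) K))) (n := 1) (by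
        rintro (a | a) <;> exact isHomogeneous_X _ _)
    rw [one_mul] at this
    exact this

-- No edge joins the two parts, so the binomial of an edge inside `D₁ ∪ D₂` becomes a pure tensor
-- with a vanishing factor. A variable outside both parts goes to `1 ⊗ₜ g (X s)`, which is zero.
open scoped TensorProduct in
theorem exists_algHom_tensorProduct {A B : Type*} [CommRing A] [Algebra K A] [CommRing B]
    [Algebra K B] {D₁ D₂ : Set V} (hd : Disjoint D₁ D₂) (h : ∀ i ∈ D₁, ∀ j ∈ D₂, ¬ G.Adj i j)
    (f : MvPolynomial (V ⊕ V) K →ₐ[K] A) (g : MvPolynomial (V ⊕ V) K →ₐ[K] B)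
    (hf : ∀ p ∈ inducedIdeal K G D₁, f p = 0) (hg : ∀ p ∈ inducedIdeal K G D₂, g p = 0) :
    ∃ Φ : MvPolynomial (V ⊕ V) K →ₐ[K] A ⊗[K] B,
      (∀ s ∈ varSet D₁, Φ (X s) = f (X s) ⊗ₜ 1) ∧ (∀ s ∉ varSet D₁, Φ (X s) = 1 ⊗ₜ g (X s)) ∧
      ∀ p ∈ inducedIdeal K G (D₁ ∪ D₂), Φ p = 0 := by
  classical
  have hd' : ∀ i ∈ D₂, i ∉ D₁ := fun i h1 h2 => Set.disjoint_left.1 hd h2 h1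
  let Φ : MvPolynomial (V ⊕ V) K →ₐ[K] A ⊗[K] B :=
    aeval fun s => if s ∈ varSet D₁ then f (X s) ⊗ₜ 1 else 1 ⊗ₜ g (X s)
  have hΦ₁ : ∀ s ∈ varSet D₁, Φ (X s) = f (X s) ⊗ₜ 1 := fun s hs => by simp [Φ, hs]
  have hΦ₂ : ∀ s ∉ varSet D₁, Φ (X s) = 1 ⊗ₜ g (X s) := fun s hs => by simp [Φ, hs]
  have hΦ₀ : ∀ s, s ∉ varSet (D₁ ∪ D₂) → Φ (X s) = 0 := by
    intro s hs
    rw [hΦ₂ s fun h => hs (Or.inl h), hg _ (X_mem fun h => hs (Or.inr h)), TensorProduct.tmul_zero]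
  refine ⟨Φ, hΦ₁, hΦ₂, ?_⟩
  have : inducedIdeal K G (D₁ ∪ D₂) ≤ RingHom.ker Φ := by
    refine inducedIdeal_le (fun i j hij => ?_) (fun s hs => hΦ₀ s hs)
    rw [RingHom.mem_ker, edgeBinomial, map_sub, map_mul, map_mul]
    by_cases hi' : i ∈ D₁ ∪ D₂
    swap
    · rw [hΦ₀ (Sum.inl i) hi', hΦ₀ (Sum.inr i) hi', zero_mul, mul_zero, sub_zero]
    by_cases hj' : j ∈ D₁ ∪ D₂
    swap
    · rw [hΦ₀ (Sum.inl j) hj', hΦ₀ (Sum.inr j) hj', zero_mul, mul_zero, sub_zero]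
    rcases hi' with hi | hi <;> rcases hj' with hj | hj
    · rw [hΦ₁ (Sum.inl i) hi, hΦ₁ (Sum.inl j) hj, hΦ₁ (Sum.inr i) hi, hΦ₁ (Sum.inr j) hj,
        Algebra.TensorProduct.tmul_mul_tmul, Algebra.TensorProduct.tmul_mul_tmul,
        ← TensorProduct.sub_tmul, ← map_mul, ← map_mul, ← map_sub]
      exact (congrArg (· ⊗ₜ _) (hf _ (edgeBinomial_mem hij))).trans (TensorProduct.zero_tmul _ _)
    · exact absurd hij (h i hi j hj)
    · exact absurd hij.symm (h j hj i hi)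
    · rw [hΦ₂ (Sum.inl i) (hd' i hi), hΦ₂ (Sum.inl j) (hd' j hj), hΦ₂ (Sum.inr i) (hd' i hi),
        hΦ₂ (Sum.inr j) (hd' j hj), Algebra.TensorProduct.tmul_mul_tmul,
        Algebra.TensorProduct.tmul_mul_tmul, one_mul, ← TensorProduct.tmul_sub, ← map_mul,
        ← map_mul, ← map_sub]
      exact (congrArg (_ ⊗ₜ ·) (hg _ (edgeBinomial_mem hij))).trans (TensorProduct.tmul_zero _ _)
  exact fun p hp => this hp

/-- The Hilbert series of a graph without edges between two parts. -/
theorem hilbertSeries_union_disjoint [Finite V] {D₁ D₂ : Set V} (hd : Disjoint D₁ D₂)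
    (h : ∀ i ∈ D₁, ∀ j ∈ D₂, ¬ G.Adj i j) :
    hilbertSeries (inducedIdeal K G (D₁ ∪ D₂)) =
      hilbertSeries (inducedIdeal K G D₁) * hilbertSeries (inducedIdeal K G D₂) := by
  obtain ⟨Φ, hΦ₁, hΦ₂, hΦ⟩ := exists_algHom_tensorProduct hd h
    (Ideal.Quotient.mkₐ K (inducedIdeal K G D₁)) (Ideal.Quotient.mkₐ K (inducedIdeal K G D₂))
    (fun p hp => Ideal.Quotient.eq_zero_iff_mem.2 hp)
    (fun p hp => Ideal.Quotient.eq_zero_iff_mem.2 hp)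
  refine hilbertSeries_eq_mul (varSet D₁) isGradedIdeal_inducedIdeal isGradedIdeal_inducedIdeal
    (fun i hi => X_mem hi) ?_ ?_ ?_ Φ hΦ₁ hΦ₂ hΦ
  · rintro (i | i) hi <;> exact X_mem fun h' => Set.disjoint_left.1 hd hi h'
  · exact retract_mem (fun i _ j _ hij => edgeBinomial_mem hij) fun s hs hs' => absurd hs hs'
  · change ∀ p ∈ inducedIdeal K G D₂, retract K (varSet D₁ᶜ) p ∈ inducedIdeal K G (D₁ ∪ D₂)
    refine retract_mem (fun i _ j _ hij => edgeBinomial_mem hij) fun s hs hs' => X_mem ?_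
    rintro (h1 | h2)
    · exact hs h1
    · exact hs' h2

end InducedIdeal

end BinomialEdge

namespace BinomialEdge

open MvPolynomial

/-! ### The Hilbert series of a complete graph -/

section Clique

/-- The relations allow indices to be exchanged between the `x`-factors and the `y`-factors, so only
the total multiset of indices and the number of `x`-factors matter. -/
theorem prod_map_mul_prod_map_eq {W R : Type*} [CommMonoid R] {x y : W → R}
    (h : ∀ i j, x i * y j = x j * y i) (p : Multiset W) :
    ∀ q p' q' : Multiset W, p + q = p' + q' → p.card = p'.card →
      (p.map x).prod * (q.map y).prod = (p'.map x).prod * (q'.map y).prod := by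
  classical
  induction p using Multiset.induction_on with
  | empty =>
    intro q p' q' h1 h2
    obtain rfl : p' = 0 := Multiset.card_eq_zero.1 (by simpa using h2.symm)
    simp only [zero_add] at h1
    rw [h1]
  | cons i p ih =>
    intro q p' q' h1 h2
    have hi : i ∈ p' + q' := by rw [← h1]; simp
    rcases Multiset.mem_add.1 hi with hi | hi
    · obtain ⟨p', rfl⟩ := Multiset.exists_cons_of_mem hi
      have := ih q p' q' (by simpa using h1) (by simpa using h2)
      simp only [Multiset.map_cons, Multiset.prod_cons, mul_assoc, this]
    -- Here `i` sits among the `y`-factors on the right; it is exchanged with some `j` from the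
    -- `x`-factors, which exists because `p'` has the positive size of `i ::ₘ p`.
    · obtain ⟨q', rfl⟩ := Multiset.exists_cons_of_mem hi
      have hp' : 0 < p'.card := by rw [← h2]; simp
      obtain ⟨j, hj⟩ := Multiset.card_pos_iff_exists_mem.1 hp'
      obtain ⟨p', rfl⟩ := Multiset.exists_cons_of_mem hj
      have := ih q p' (j ::ₘ q') (by
        simp only [Multiset.cons_add, Multiset.add_cons] at h1 ⊢
        exact (Multiset.cons_inj_right i).1 h1) (by simpa using h2)
      simp only [Multiset.map_cons, Multiset.prod_cons] at this ⊢
      calc x i * (p.map x).prod * (q.map y).prod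
          = x i * ((p'.map x).prod * (y j * (q'.map y).prod)) := by rw [mul_assoc, this]
        _ = (x i * y j) * ((p'.map x).prod * (q'.map y).prod) := by
          simp only [mul_assoc, mul_left_comm]
        _ = _ := by
          rw [h i j]
          simp only [mul_assoc, mul_left_comm]

theorem prod_map_X {σ K : Type*} [CommSemiring K] [DecidableEq σ] (M : Multiset σ) :
    (M.map (X : σ → MvPolynomial σ K)).prod = monomial (Multiset.toFinsupp M) 1 := by
  induction M using Multiset.induction_on with
  | empty => simp
  | cons i M ih =>
    rw [Multiset.map_cons, Multiset.prod_cons, ih, ← Multiset.singleton_add, map_add,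
      Multiset.toFinsupp_singleton, X, monomial_mul, one_mul]

theorem exists_eq_map_inl_add_map_inr {α β : Type*} (M : Multiset (α ⊕ β)) :
    ∃ p q, M = Multiset.map Sum.inl p + Multiset.map Sum.inr q := by
  induction M using Multiset.induction_on with
  | empty => exact ⟨0, 0, rfl⟩
  | cons i M ih =>
    obtain ⟨p, q, rfl⟩ := ih
    rcases i with i | i
    · exact ⟨i ::ₘ p, q, by simp⟩
    · exact ⟨p, i ::ₘ q, by simp⟩

variable {W K : Type*} [Field K]

/-- The polynomial `∏ x_i ∏ y_j`. -/
noncomputable def splitMonomial (K : Type*) [Field K] (p q : Multiset W) :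
    MvPolynomial (W ⊕ W) K :=
  (p.map fun i => X (Sum.inl i)).prod * (q.map fun i => X (Sum.inr i)).prod

theorem isHomogeneous_prod_map_X {σ ι : Type*} (f : ι → σ) (M : Multiset ι) :
    ((M.map fun i => (X (f i) : MvPolynomial σ K)).prod).IsHomogeneous M.card := by
  induction M using Multiset.induction_on with
  | empty => simpa using isHomogeneous_one _ _
  | cons i M ih =>
    rw [Multiset.map_cons, Multiset.prod_cons, Multiset.card_cons, add_comm]
    exact (isHomogeneous_X _ _).mul ih

theorem isHomogeneous_splitMonomial (p q : Multiset W) :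
    (splitMonomial K p q).IsHomogeneous (p.card + q.card) :=
  (isHomogeneous_prod_map_X _ p).mul (isHomogeneous_prod_map_X _ q)

theorem mk_splitMonomial_eq {p q p' q' : Multiset W} (h : p + q = p' + q')
    (hc : p.card = p'.card) :
    Ideal.Quotient.mk (binomialEdgeIdeal K (⊤ : SimpleGraph W)) (splitMonomial K p q) =
      Ideal.Quotient.mk _ (splitMonomial K p' q') := by
  simp only [splitMonomial, map_mul, map_multiset_prod, Multiset.map_map, Function.comp_def]
  refine prod_map_mul_prod_map_eq (fun i j => ?_) p q p' q' h hc
  by_cases hij : i = j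
  · rw [hij]
  · rw [← map_mul, ← map_mul, Ideal.Quotient.eq]
    exact Ideal.subset_span ⟨i, j, hij, rfl⟩

/-- The parametrization `x_i = t z_i`, `y_i = z_i` of the generic matrix of rank one. -/
noncomputable def rankOne (K W : Type*) [Field K] :
    MvPolynomial (W ⊕ W) K →ₐ[K] MvPolynomial (Option W) K :=
  aeval (Sum.elim (fun i => X none * X (some i)) (fun i => X (some i)))

theorem rankOne_eq_zero {p : MvPolynomial (W ⊕ W) K}
    (hp : p ∈ binomialEdgeIdeal K (⊤ : SimpleGraph W)) : rankOne K W p = 0 := by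
  have : binomialEdgeIdeal K (⊤ : SimpleGraph W) ≤ RingHom.ker (rankOne K W) := by
    refine Ideal.span_le.2 ?_
    rintro _ ⟨i, j, -, rfl⟩
    rw [SetLike.mem_coe, RingHom.mem_ker]
    simp only [rankOne, map_sub, map_mul, aeval_X, Sum.elim_inl, Sum.elim_inr]
    ring
  exact this hp

/-- The exponent of `none` records the number of `x`-factors and the other exponents record the
multiset of indices, so `rankOne` separates the classes that the exchange relations leave distinct.
-/
theorem rankOne_splitMonomial [DecidableEq W] (p q : Multiset W) :
    rankOne K W (splitMonomial K p q) = monomial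
      (Multiset.toFinsupp (Multiset.replicate p.card none + (p + q).map some)) 1 := by
  rw [← prod_map_X]
  simp [splitMonomial, rankOne, map_multiset_prod, Multiset.map_map, Function.comp_def,
    Multiset.prod_map_mul, mul_assoc]

theorem hilbertFunction_top [Fintype W] (k : ℕ) :
    hilbertFunction (binomialEdgeIdeal K (⊤ : SimpleGraph W)) k =
      (Fintype.card W).multichoose k * (k + 1) := by
  classical
  -- A class in degree `k` is given by a multiset of `k` indices and a number of `x`-factors between
  -- `0` and `k`. Which indices go to the `x`-factors is immaterial in the quotient; `toList` makes
  -- some choice.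
  let β : Sym W k × Fin (k + 1) → MvPolynomial (W ⊕ W) K := fun x =>
    splitMonomial K (x.1.1.toList.take x.2 : Multiset W) (x.1.1.toList.drop x.2 : Multiset W)
  have hadd : ∀ x : Sym W k × Fin (k + 1),
      (x.1.1.toList.take x.2 : Multiset W) + (x.1.1.toList.drop x.2 : Multiset W) = x.1.1 := by
    intro x
    rw [Multiset.coe_add, List.take_append_drop, Multiset.coe_toList]
  have hcard : ∀ x : Sym W k × Fin (k + 1),
      (x.1.1.toList.take x.2 : Multiset W).card = x.2 := by
    intro x
    have := x.2.2
    rw [Multiset.coe_card, List.length_take, Multiset.length_toList, x.1.2]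
    omega
  have hβ : ∀ x, (β x).IsHomogeneous k := by
    intro x
    have := isHomogeneous_splitMonomial (K := K) (x.1.1.toList.take x.2 : Multiset W)
      (x.1.1.toList.drop x.2 : Multiset W)
    rwa [← Multiset.card_add, hadd, x.1.2] at this
  have hli : LinearIndependent K fun x =>
      Ideal.Quotient.mk (binomialEdgeIdeal K (⊤ : SimpleGraph W)) (β x) := by
    let f := Ideal.Quotient.liftₐ (binomialEdgeIdeal K (⊤ : SimpleGraph W)) (rankOne K W)
      (fun p hp => rankOne_eq_zero hp)
    apply LinearIndependent.of_comp f.toLinearMap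
    let g : Sym W k × Fin (k + 1) → (Option W →₀ ℕ) := fun x =>
      Multiset.toFinsupp (Multiset.replicate x.2 none + x.1.1.map some)
    have hfg : f.toLinearMap ∘ (fun x =>
        Ideal.Quotient.mk (binomialEdgeIdeal K (⊤ : SimpleGraph W)) (β x)) =
        (basisMonomials (Option W) K) ∘ g := by
      funext x
      have := rankOne_splitMonomial (K := K) (x.1.1.toList.take x.2 : Multiset W)
        (x.1.1.toList.drop x.2 : Multiset W)
      rw [hadd, hcard] at this
      rw [Function.comp_apply, Function.comp_apply, coe_basisMonomials]
      exact this
    rw [hfg]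
    refine (basisMonomials (Option W) K).linearIndependent.comp g ?_
    rintro ⟨d, a⟩ ⟨d', a'⟩ h
    have h1 := Multiset.toFinsupp.injective h
    have h2 : a = a' := by
      have := congrArg (Multiset.count none) h1
      simpa [Multiset.count_replicate, Fin.ext_iff] using this
    subst h2
    have h3 := Multiset.map_injective (Option.some_injective W) (add_left_cancel h1)
    have h4 : d = d' := Subtype.ext h3
    rw [h4]
  rw [hilbertFunction_eq_card β (fun _ => k) hβ hli k]
  · simp [Sym.card_sym_eq_multichoose]
  · rintro r hr
    obtain ⟨p, hp, rfl⟩ := mem_gradedPart.1 hr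
    rw [p.as_sum, map_sum]
    refine Submodule.sum_mem _ fun m hm => ?_
    have hmk : m.degree = k := by
      by_contra hne
      exact (mem_support_iff.1 hm) (hp.coeff_eq_zero hne)
    have e1 : monomial m (coeff m p) = coeff m p • monomial m (1 : K) := by
      simp [smul_monomial]
    obtain ⟨a, b, hab⟩ := exists_eq_map_inl_add_map_inr (Finsupp.toMultiset m)
    have e2 : monomial m (1 : K) = splitMonomial K a b := by
      rw [← Finsupp.toMultiset_toFinsupp m, hab, ← prod_map_X]
      simp [splitMonomial, Multiset.map_map]
    have e3 : (a + b).card = k := by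
      have := Finsupp.card_toMultiset m
      rw [hab] at this
      rw [← hmk, Finsupp.degree_apply, Multiset.card_add]
      simpa [Finsupp.sum] using this
    let x : Sym W k × Fin (k + 1) := ⟨⟨a + b, e3⟩, ⟨a.card, by
      rw [Multiset.card_add] at e3; omega⟩⟩
    have key : Ideal.Quotient.mk (binomialEdgeIdeal K (⊤ : SimpleGraph W)) (monomial m (1 : K)) ∈
        Submodule.span K ((fun i => Ideal.Quotient.mk (binomialEdgeIdeal K ⊤) (β i)) ''
          {i | k = k}) := by
      refine Submodule.subset_span ⟨x, rfl, ?_⟩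
      rw [e2]
      exact mk_splitMonomial_eq (hadd x) (hcard x)
    rw [e1]
    exact Submodule.smul_mem _ (coeff m p) key

/-- The generating function of the multiset numbers. -/
noncomputable def multichooseSeries (n : ℕ) : PowerSeries ℤ :=
  PowerSeries.mk fun k => (n.multichoose k : ℤ)

theorem one_sub_X_mul_multichooseSeries (n : ℕ) :
    (1 - PowerSeries.X) * multichooseSeries (n + 1) = multichooseSeries n := by
  ext (_ | k)
  · simp [sub_mul, multichooseSeries]
  · simp [sub_mul, multichooseSeries, PowerSeries.coeff_succ_X_mul, Nat.multichoose_succ_succ]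

theorem one_sub_X_pow_mul_multichooseSeries (n : ℕ) :
    (1 - PowerSeries.X) ^ n * multichooseSeries n = 1 := by
  induction n with
  | zero =>
    ext (_ | k) <;> simp [multichooseSeries, PowerSeries.coeff_one]
  | succ n ih => rw [pow_succ, mul_assoc, one_sub_X_mul_multichooseSeries, ih]

theorem hilbertSeries_top [Fintype W] :
    (1 - PowerSeries.X) ^ (Fintype.card W + 1) *
      hilbertSeries (binomialEdgeIdeal K (⊤ : SimpleGraph W)) =
        1 - PowerSeries.X + (Fintype.card W : PowerSeries ℤ) * PowerSeries.X := by
  set n := Fintype.card W with hn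
  -- This splits `multichoose n k * (k + 1)` with the help of `k * multichoose n k = n * multichoose
  -- (n + 1) (k - 1)` for `k > 0`.
  have h : hilbertSeries (binomialEdgeIdeal K (⊤ : SimpleGraph W)) =
      multichooseSeries n + (n : PowerSeries ℤ) * (PowerSeries.X * multichooseSeries (n + 1)) := by
    ext k
    simp only [hilbertSeries, PowerSeries.coeff_mk, hilbertFunction_top, ← hn, map_add]
    have hc : ∀ f : PowerSeries ℤ, (PowerSeries.coeff k) ((n : PowerSeries ℤ) * f) =
        n * PowerSeries.coeff k f := by
      intro f
      rw [← nsmul_eq_mul, map_nsmul, nsmul_eq_mul]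
    rw [hc]
    rcases k with _ | k
    · simp [multichooseSeries]
    · rw [PowerSeries.coeff_succ_X_mul]
      simp only [multichooseSeries, PowerSeries.coeff_mk]
      have := Nat.choose_succ_right_eq (n + k) k
      rw [Nat.multichoose_eq, Nat.multichoose_eq, show n + (k + 1) - 1 = n + k by omega,
        show n + 1 + k - 1 = n + k by omega]
      rw [show n + k - k = n by omega] at this
      have h2 : ((n + k).choose (k + 1) : ℤ) * (k + 1) = (n + k).choose k * n := by
        exact_mod_cast this
      push_cast
      linarith
  have h1 := one_sub_X_pow_mul_multichooseSeries n
  have h2 := one_sub_X_pow_mul_multichooseSeries (n + 1)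
  rw [h, mul_add, pow_succ, mul_right_comm, h1, one_mul,
    show (1 - PowerSeries.X) ^ n * (1 - PowerSeries.X) *
      ((n : PowerSeries ℤ) * (PowerSeries.X * multichooseSeries (n + 1))) =
      (n : PowerSeries ℤ) * PowerSeries.X * ((1 - PowerSeries.X) ^ (n + 1) * multichooseSeries (n + 1)) by ring, h2,
    mul_one]

end Clique

end BinomialEdge

namespace BinomialEdge

/-! ### The recursion on graphs and the gluing formula -/

section Gluing

variable {V : Type*} {K : Type*} [Field K]

/-- The Hilbert series of the binomial edge ideal of the induced graph `G[D]`. -/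
noncomputable def inducedSeries (K : Type*) [Field K] (G : SimpleGraph V) (D : Set V) :
    PowerSeries ℤ :=
  hilbertSeries (inducedIdeal K G D)

/-- The neighbours of `v` in `D` are pairwise adjacent. -/
def IsSimplicialIn (G : SimpleGraph V) (D : Set V) (v : V) : Prop :=
  ∀ i ∈ D, ∀ j ∈ D, G.Adj v i → G.Adj v j → i ≠ j → G.Adj i j

theorem IsSimplicialIn.mono {G : SimpleGraph V} {D D' : Set V} {v : V}
    (h : IsSimplicialIn G D v) (hD : D' ⊆ D) : IsSimplicialIn G D' v :=
  fun i hi j hj => h i (hD hi) j (hD hj)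

theorem one_sub_X_ne_zero : (1 - PowerSeries.X : PowerSeries ℤ) ≠ 0 := by
  intro h
  have := congrArg (PowerSeries.coeff 0) h
  simp at this

variable {G : SimpleGraph V}

theorem inducedSeries_of_isClique [Finite V] {D : Set V} (h : G.IsClique D) :
    (1 - PowerSeries.X) ^ (D.ncard + 1) * inducedSeries K G D =
      1 - PowerSeries.X + (D.ncard : PowerSeries ℤ) * PowerSeries.X := by
  have := Fintype.ofFinite D
  have h1 := hilbertSeries_top (K := K) (W := D)
  rw [Fintype.card_eq_nat_card, Nat.card_coe_set_eq] at h1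
  rw [inducedSeries, ← hilbertSeries_binomialEdgeIdeal_induce (⊤ : SimpleGraph D), h1]
  intro a b
  rw [SimpleGraph.top_adj]
  constructor
  · intro hab
    exact h a.2 b.2 fun he => hab (Subtype.ext he)
  · intro hab he
    exact G.loopless.irrefl b.1 (he ▸ hab)

/-- The number of ordered pairs of non-adjacent vertices in `D`. -/
noncomputable def nonAdjCount (G : SimpleGraph V) (D : Set V) : ℕ :=
  Set.ncard {p : V × V | p.1 ∈ D ∧ p.2 ∈ D ∧ ¬ G.Adj p.1 p.2}

/-- Diagonal pairs `(u, u)` are counted, so deleting a vertex lowers the count even if it is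
adjacent to all the others. -/
theorem nonAdjCount_lt_of_ssubset [Finite V] {D D' : Set V} (h : D' ⊂ D) :
    nonAdjCount G D' < nonAdjCount G D := by
  obtain ⟨hs, u, hu, hu'⟩ := Set.ssubset_iff_exists.1 h
  refine Set.ncard_lt_ncard ((Set.ssubset_iff_of_subset ?_).2 ⟨(u, u), ?_, ?_⟩)
  · exact fun p hp => ⟨hs hp.1, hs hp.2.1, hp.2.2⟩
  · exact ⟨hu, hu, G.loopless.irrefl u⟩
  · exact fun hp => hu' hp.1

theorem nonAdjCount_completeAt_le [Finite V] (D : Set V) (u : V) :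
    nonAdjCount (completeAt G u) D ≤ nonAdjCount G D :=
  Set.ncard_le_ncard fun _ hp => ⟨hp.1, hp.2.1, fun h => hp.2.2 (Or.inl h)⟩

theorem nonAdjCount_completeAt_lt [Finite V] {D : Set V} {u : V} (h : ¬ IsSimplicialIn G D u) :
    nonAdjCount (completeAt G u) D < nonAdjCount G D := by
  simp only [IsSimplicialIn, not_forall] at h
  obtain ⟨i, hi, j, hj, hui, huj, hne, hij⟩ := h
  refine Set.ncard_lt_ncard ((Set.ssubset_iff_of_subset ?_).2 ⟨(i, j), ⟨hi, hj, hij⟩, ?_⟩)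
  · exact fun _ hp => ⟨hp.1, hp.2.1, fun h => hp.2.2 (Or.inl h)⟩
  · exact fun hp => hp.2.2 (Or.inr ⟨hne, hui, huj⟩)

theorem inducedSeries_completeAt [Finite V] (D : Set V) (u : V) :
    inducedSeries K G D + inducedSeries K (completeAt G u) (D \ {u}) =
      inducedSeries K (completeAt G u) D + inducedSeries K G (D \ {u}) :=
  hilbertSeries_completeAt G D u

theorem inducedSeries_union [Finite V] {D₁ D₂ : Set V} (hd : Disjoint D₁ D₂)
    (h : ∀ i ∈ D₁, ∀ j ∈ D₂, ¬ G.Adj i j) :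
    inducedSeries K G (D₁ ∪ D₂) = inducedSeries K G D₁ * inducedSeries K G D₂ :=
  hilbertSeries_union_disjoint hd h

/-- The vertices of `D` that are equal or adjacent to `u`. -/
def closedNeighbors (G : SimpleGraph V) (D : Set V) (u : V) : Set V :=
  {i | i ∈ D ∧ (i = u ∨ G.Adj u i)}

theorem closedNeighbors_subset {D : Set V} {u : V} : closedNeighbors G D u ⊆ D := fun _ h => h.1

theorem isClique_closedNeighbors {D : Set V} {u : V} (h : IsSimplicialIn G D u) :
    G.IsClique (closedNeighbors G D u) := by
  rintro i ⟨hi, rfl | hui⟩ j ⟨hj, rfl | huj⟩ hij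
  · exact absurd rfl hij
  · exact huj
  · exact hui.symm
  · exact h i hi j hj hui huj hij

/-- If all vertices are simplicial, being equal or adjacent is transitive on `D`, so a closed
neighbourhood is a whole connected component. -/
theorem not_adj_of_mem_closedNeighbors {D : Set V} (h : ∀ u ∈ D, IsSimplicialIn G D u) {u i j : V}
    (hu : u ∈ D) (hi : i ∈ closedNeighbors G D u) (hj : j ∈ D \ closedNeighbors G D u) :
    ¬ G.Adj i j := by
  intro hij
  rcases hi with ⟨hi, rfl | hui⟩
  · exact hj.2 ⟨hj.1, Or.inr hij⟩
  · refine hj.2 ⟨hj.1, ?_⟩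
    by_cases hju : j = u
    · exact Or.inl hju
    · exact Or.inr (h i hi u hu j hj.1 hui.symm hij (Ne.symm hju))

theorem inducedSeries_eq_closedNeighbors_mul [Finite V] {D : Set V} (h : ∀ u ∈ D, IsSimplicialIn G D u)
    {u : V} (hu : u ∈ D) :
    inducedSeries K G D = inducedSeries K G (closedNeighbors G D u) *
      inducedSeries K G (D \ closedNeighbors G D u) := by
  rw [← inducedSeries_union Set.disjoint_sdiff_right fun i hi j hj =>
    not_adj_of_mem_closedNeighbors h hu hi hj, Set.union_sdiff_cancel closedNeighbors_subset]

/-- A power series that becomes a polynomial when multiplied by a power of `1 - X`. -/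
def IsHilbertRational (f : PowerSeries ℤ) : Prop :=
  ∃ (N : ℕ) (P : Polynomial ℤ), (1 - PowerSeries.X) ^ N * f = (P : PowerSeries ℤ)

theorem coe_one_sub_X : ((1 - Polynomial.X : Polynomial ℤ) : PowerSeries ℤ) =
    1 - PowerSeries.X := by
  simp

theorem IsHilbertRational.mul {f g : PowerSeries ℤ} (hf : IsHilbertRational f)
    (hg : IsHilbertRational g) : IsHilbertRational (f * g) := by
  obtain ⟨N, P, hP⟩ := hf
  obtain ⟨M, Q, hQ⟩ := hg
  refine ⟨N + M, P * Q, ?_⟩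
  rw [Polynomial.coe_mul, ← hP, ← hQ]
  ring

theorem IsHilbertRational.add {f g : PowerSeries ℤ} (hf : IsHilbertRational f)
    (hg : IsHilbertRational g) : IsHilbertRational (f + g) := by
  obtain ⟨N, P, hP⟩ := hf
  obtain ⟨M, Q, hQ⟩ := hg
  refine ⟨N + M, (1 - Polynomial.X) ^ M * P + (1 - Polynomial.X) ^ N * Q, ?_⟩
  rw [Polynomial.coe_add, Polynomial.coe_mul, Polynomial.coe_mul, Polynomial.coe_pow,
    Polynomial.coe_pow, coe_one_sub_X, ← hP, ← hQ]
  ring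

theorem IsHilbertRational.neg {f : PowerSeries ℤ} (hf : IsHilbertRational f) :
    IsHilbertRational (-f) := by
  obtain ⟨N, P, hP⟩ := hf
  refine ⟨N, -P, ?_⟩
  rw [Polynomial.coe_neg, ← hP]
  ring

/-- Rationality comes from the recursion that also proves the gluing formula: cliques have explicit
rational series, and products, sums and negatives preserve rationality. -/
theorem isHilbertRational_inducedSeries [Finite V] (G : SimpleGraph V) (D : Set V) :
    IsHilbertRational (inducedSeries K G D) := by
  induction hn : nonAdjCount G D using Nat.strong_induction_on generalizing G D with
  | _ n ih =>
    subst hn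
    by_cases h : ∀ u ∈ D, IsSimplicialIn G D u
    · rcases D.eq_empty_or_nonempty with rfl | ⟨u, hu⟩
      · have := inducedSeries_of_isClique (K := K) (G := G) (D := ∅) SimpleGraph.isClique_empty
        exact ⟨_, 1 - Polynomial.X, by rw [this, coe_one_sub_X]; simp⟩
      · rw [inducedSeries_eq_closedNeighbors_mul h hu]
        refine IsHilbertRational.mul ?_ (ih _ (nonAdjCount_lt_of_ssubset ?_) _ _ rfl)
        · refine ⟨(closedNeighbors G D u).ncard + 1, 1 - Polynomial.X + ((closedNeighbors G D u).ncard : Polynomial ℤ) *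
            Polynomial.X, ?_⟩
          rw [inducedSeries_of_isClique (isClique_closedNeighbors (h u hu)), Polynomial.coe_add,
            coe_one_sub_X, Polynomial.coe_mul, Polynomial.coe_X]
          congr 2
          exact (map_natCast (Polynomial.coeToPowerSeries.ringHom (R := ℤ)) _).symm
        · refine (Set.ssubset_iff_of_subset Set.sdiff_subset).2 ⟨u, hu, fun h' => h'.2 ⟨hu, Or.inl rfl⟩⟩
    · simp only [not_forall] at h
      obtain ⟨u, hu, hs⟩ := h
      have hlt : D \ {u} ⊂ D :=
        (Set.ssubset_iff_of_subset Set.sdiff_subset).2 ⟨u, hu, fun h' => h'.2 rfl⟩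
      have h1 := ih _ (nonAdjCount_completeAt_lt hs) _ _ rfl
      have h2 := ih _ (nonAdjCount_lt_of_ssubset (G := G) hlt) _ _ rfl
      have h3 := ih _ ((nonAdjCount_completeAt_le (G := G) (D \ {u}) u).trans_lt
        (nonAdjCount_lt_of_ssubset (G := G) hlt)) _ _ rfl
      have := inducedSeries_completeAt (K := K) (G := G) D u
      rw [eq_add_neg_of_add_eq this]
      exact (h1.add h2).add h3.neg

/-- `G[D₁ ∪ D₂]` is glued from `G[D₁]` and `G[D₂]` at the vertex `v`. -/
structure IsGluedAt (G : SimpleGraph V) (D₁ D₂ : Set V) (v : V) : Prop where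
  inter_eq : D₁ ∩ D₂ = {v}
  not_adj : ∀ i ∈ D₁, ∀ j ∈ D₂, i ≠ v → j ≠ v → ¬ G.Adj i j
  left : IsSimplicialIn G D₁ v
  right : IsSimplicialIn G D₂ v

theorem IsGluedAt.symm {D₁ D₂ : Set V} {v : V} (h : IsGluedAt G D₁ D₂ v) :
    IsGluedAt G D₂ D₁ v where
  inter_eq := by rw [Set.inter_comm, h.inter_eq]
  not_adj i hi j hj hiv hjv hij := h.not_adj j hj i hi hjv hiv hij.symm
  left := h.right
  right := h.left

theorem IsGluedAt.mem_left {D₁ D₂ : Set V} {v : V} (h : IsGluedAt G D₁ D₂ v) : v ∈ D₁ :=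
  (h.inter_eq.symm ▸ Set.mem_singleton v : v ∈ D₁ ∩ D₂).1

theorem IsGluedAt.mem_right {D₁ D₂ : Set V} {v : V} (h : IsGluedAt G D₁ D₂ v) : v ∈ D₂ :=
  h.symm.mem_left

theorem IsGluedAt.eq_of_mem {D₁ D₂ : Set V} {v i : V} (h : IsGluedAt G D₁ D₂ v) (h₁ : i ∈ D₁)
    (h₂ : i ∈ D₂) : i = v := by
  have : i ∈ D₁ ∩ D₂ := ⟨h₁, h₂⟩
  rwa [h.inter_eq] at this

theorem IsGluedAt.subset_left {D₁ D₂ D : Set V} {v : V} (h : IsGluedAt G D₁ D₂ v) (hD : D ⊆ D₁)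
    (hv : v ∈ D) : IsGluedAt G D D₂ v where
  inter_eq := by
    ext i
    constructor
    · exact fun hi => h.eq_of_mem (hD hi.1) hi.2
    · rintro rfl
      exact ⟨hv, h.mem_right⟩
  not_adj i hi j hj := h.not_adj i (hD hi) j hj
  left := h.left.mono hD
  right := h.right

theorem IsGluedAt.not_adj_of_mem_right {D₁ D₂ : Set V} {u v i : V} (h : IsGluedAt G D₁ D₂ v)
    (hu : u ∈ D₁) (huv : u ≠ v) (hi : i ∈ D₂) (hui : G.Adj u i) : i = v := by
  by_contra hne
  exact h.not_adj u hu i hi huv hne hui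

/-- The only possible neighbour of `u` in `D₂` is `v`, so completion adds no edge inside `D₂` and
none across that avoids `v`. If `u` is adjacent to `v`, then after completion every neighbour of `v`
in `D₁` other than `u` is a neighbour of `u`, and these have been made pairwise adjacent. -/
theorem IsGluedAt.completeAt {D₁ D₂ : Set V} {u v : V} (h : IsGluedAt G D₁ D₂ v) (hu : u ∈ D₁)
    (huv : u ≠ v) : IsGluedAt (completeAt G u) D₁ D₂ v where
  inter_eq := h.inter_eq
  not_adj := by
    rintro i hi j hj hiv hjv (hij | ⟨-, -, h2⟩)
    · exact h.not_adj i hi j hj hiv hjv hij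
    · exact hjv (h.not_adj_of_mem_right hu huv hj h2)
  left := by
    intro i hi j hj hvi hvj hij
    rw [completeAt_adj] at hvi hvj ⊢
    by_cases huv' : G.Adj u v
    · have key : ∀ i ∈ D₁, i ≠ u → (G.Adj v i ∨ (v ≠ i ∧ G.Adj u v ∧ G.Adj u i)) → G.Adj u i := by
        rintro i hi hiu (hvi | ⟨-, -, h⟩)
        · exact h.left u hu i hi huv'.symm hvi (Ne.symm hiu)
        · exact h
      by_cases hiu : i = u
      · subst hiu
        exact Or.inl (key j hj (Ne.symm hij) hvj)
      · by_cases hju : j = u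
        · subst hju
          exact Or.inl (key i hi hij hvi).symm
        · exact Or.inr ⟨hij, key i hi hiu hvi, key j hj hju hvj⟩
    · have h1 : G.Adj v i := hvi.resolve_right fun h => huv' h.2.1
      have h2 : G.Adj v j := hvj.resolve_right fun h => huv' h.2.1
      exact Or.inl (h.left i hi j hj h1 h2 hij)
  right := by
    intro i hi j hj hvi hvj hij
    rw [completeAt_adj] at hvi hvj ⊢
    have key : ∀ i ∈ D₂, (G.Adj v i ∨ (v ≠ i ∧ G.Adj u v ∧ G.Adj u i)) → G.Adj v i := by
      rintro i hi (hvi | ⟨h1, -, h2⟩)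
      · exact hvi
      · exact absurd (h.not_adj_of_mem_right hu huv hi h2).symm h1
    exact Or.inl (h.right i hi j hj (key i hi hvi) (key j hj hvj) hij)

theorem IsGluedAt.inducedSeries_completeAt_right {D₁ D₂ : Set V} {u v : V}
    (h : IsGluedAt G D₁ D₂ v) (hu : u ∈ D₁) (huv : u ≠ v) :
    inducedSeries K (BinomialEdge.completeAt G u) D₂ = inducedSeries K G D₂ := by
  rw [inducedSeries, inducedSeries, inducedIdeal_congr]
  intro i hi j hj
  rw [completeAt_adj]
  constructor
  · rintro (hij | ⟨hij, h1, h2⟩)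
    · exact hij
    · exact absurd ((h.not_adj_of_mem_right hu huv hi h1).trans
        (h.not_adj_of_mem_right hu huv hj h2).symm) hij
  · exact Or.inl

/-- The series of `D₂` is the same for `G` and its completion. Hence the recursion for `D₁ ∪ D₂` is
the recursion for `D₁` multiplied by `(1 - X)^2` and that series. -/
theorem IsGluedAt.inducedSeries_of_completeAt [Finite V] {D₁ D₂ : Set V} {u v : V}
    (h : IsGluedAt G D₁ D₂ v) (hu : u ∈ D₁) (huv : u ≠ v)
    (h₁ : inducedSeries K (BinomialEdge.completeAt G u) (D₁ ∪ D₂) = (1 - PowerSeries.X) ^ 2 *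
      inducedSeries K (BinomialEdge.completeAt G u) D₁ *
      inducedSeries K (BinomialEdge.completeAt G u) D₂)
    (h₂ : inducedSeries K G (D₁ \ {u} ∪ D₂) = (1 - PowerSeries.X) ^ 2 *
      inducedSeries K G (D₁ \ {u}) * inducedSeries K G D₂)
    (h₃ : inducedSeries K (BinomialEdge.completeAt G u) (D₁ \ {u} ∪ D₂) =
      (1 - PowerSeries.X) ^ 2 * inducedSeries K (BinomialEdge.completeAt G u) (D₁ \ {u}) *
      inducedSeries K (BinomialEdge.completeAt G u) D₂) :
    inducedSeries K G (D₁ ∪ D₂) =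
      (1 - PowerSeries.X) ^ 2 * inducedSeries K G D₁ * inducedSeries K G D₂ := by
  have e : (D₁ ∪ D₂) \ {u} = D₁ \ {u} ∪ D₂ := by
    rw [Set.union_sdiff_distrib, Set.sdiff_singleton_eq_self (s := D₂)]
    exact fun h' => huv (h.eq_of_mem hu h')
  have o := inducedSeries_completeAt (K := K) (G := G) (D₁ ∪ D₂) u
  have o₁ := inducedSeries_completeAt (K := K) (G := G) D₁ u
  rw [h.inducedSeries_completeAt_right hu huv] at h₁ h₃
  rw [e, h₁, h₂, h₃] at o
  linear_combination o - (1 - PowerSeries.X) ^ 2 * inducedSeries K G D₂ * o₁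

/-- The recursion is applied at `v` itself: completion turns the union into one clique, and deletion
of `v` leaves two disjoint cliques. -/
theorem IsGluedAt.inducedSeries_of_isClique_of_isClique [Finite V] {C₁ C₂ : Set V} {v : V} (h : IsGluedAt G C₁ C₂ v)
    (c₁ : G.IsClique C₁) (c₂ : G.IsClique C₂) :
    inducedSeries K G (C₁ ∪ C₂) =
      (1 - PowerSeries.X) ^ 2 * inducedSeries K G C₁ * inducedSeries K G C₂ := by
  obtain ⟨a, ha⟩ : ∃ a, C₁.ncard = a + 1 := ⟨C₁.ncard - 1, by
    have := (Set.ncard_pos (Set.toFinite C₁)).2 ⟨v, h.mem_left⟩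
    omega⟩
  obtain ⟨b, hb⟩ : ∃ b, C₂.ncard = b + 1 := ⟨C₂.ncard - 1, by
    have := (Set.ncard_pos (Set.toFinite C₂)).2 ⟨v, h.mem_right⟩
    omega⟩
  have ha' : (C₁ \ {v}).ncard = a := by
    rw [Set.ncard_sdiff_singleton_of_mem h.mem_left, ha]
    omega
  have hb' : (C₂ \ {v}).ncard = b := by
    rw [Set.ncard_sdiff_singleton_of_mem h.mem_right, hb]
    omega
  have hu : (C₁ ∪ C₂).ncard = a + b + 1 := by
    have := Set.ncard_union_add_ncard_inter C₁ C₂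
    rw [h.inter_eq, Set.ncard_singleton, ha, hb] at this
    omega
  have hu' : ((C₁ ∪ C₂) \ {v}).ncard = a + b := by
    rw [Set.ncard_sdiff_singleton_of_mem (Set.mem_union_left _ h.mem_left), hu]
    omega
  have cu : (BinomialEdge.completeAt G v).IsClique (C₁ ∪ C₂) := by
    have key : ∀ i ∈ C₁ ∪ C₂, i ≠ v → G.Adj v i := by
      rintro i (hi | hi) hiv
      · exact c₁ h.mem_left hi (Ne.symm hiv)
      · exact c₂ h.mem_right hi (Ne.symm hiv)
    intro i hi j hj hij
    rw [completeAt_adj]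
    by_cases hiv : i = v
    · subst hiv
      exact Or.inl (key j hj (Ne.symm hij))
    · by_cases hjv : j = v
      · subst hjv
        exact Or.inl (key i hi hij).symm
      · exact Or.inr ⟨hij, key i hi hiv, key j hj hjv⟩
  have e : inducedSeries K G ((C₁ ∪ C₂) \ {v}) =
      inducedSeries K G (C₁ \ {v}) * inducedSeries K G (C₂ \ {v}) := by
    rw [Set.union_sdiff_distrib]
    refine inducedSeries_union (Set.disjoint_left.2 fun i hi hi' =>
      hi.2 (h.eq_of_mem hi.1 hi'.1)) fun i hi j hj => h.not_adj i hi.1 j hj.1 hi.2 hj.2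
  have o := inducedSeries_completeAt (K := K) (G := G) (C₁ ∪ C₂) v
  have f₁ := inducedSeries_of_isClique (K := K) c₁
  have f₂ := inducedSeries_of_isClique (K := K) c₂
  have f₃ := inducedSeries_of_isClique (K := K) (c₁.subset (Set.sdiff_subset (t := {v})))
  have f₄ := inducedSeries_of_isClique (K := K) (c₂.subset (Set.sdiff_subset (t := {v})))
  have f₅ := inducedSeries_of_isClique (K := K) cu
  have f₆ := inducedSeries_of_isClique (K := K) (cu.subset (Set.sdiff_subset (t := {v})))
  rw [ha] at f₁
  rw [hb] at f₂
  rw [ha'] at f₃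
  rw [hb'] at f₄
  rw [hu] at f₅
  rw [hu'] at f₆
  rw [e] at o
  push_cast at f₁ f₂ f₃ f₄ f₅ f₆
  -- The union has `a + b + 1` vertices, so the exponent `a + b + 2` clears every denominator.
  apply mul_left_cancel₀ (pow_ne_zero (a + b + 2) one_sub_X_ne_zero)
  set T : PowerSeries ℤ := 1 - PowerSeries.X with hT
  have hX : PowerSeries.X = 1 - T := by rw [hT]; ring
  have g₁ : T ^ (a + b + 2) * (T ^ 2 * inducedSeries K G C₁ * inducedSeries K G C₂) =
      (T ^ (a + 1 + 1) * inducedSeries K G C₁) * (T ^ (b + 1 + 1) * inducedSeries K G C₂) := by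
    ring
  have g₂ : T ^ (a + b + 2) * (inducedSeries K G (C₁ \ {v}) * inducedSeries K G (C₂ \ {v})) =
      (T ^ (a + 1) * inducedSeries K G (C₁ \ {v})) *
        (T ^ (b + 1) * inducedSeries K G (C₂ \ {v})) := by
    ring
  rw [g₁, f₁, f₂, eq_sub_of_add_eq o, mul_sub, mul_add, g₂, f₃, f₄]
  rw [show T ^ (a + b + 2) = T ^ (a + b + 1 + 1) by ring, f₅,
    show T ^ (a + b + 1 + 1) = T * T ^ (a + b + 1) by ring, mul_assoc, f₆, hX]
  ring

/-- The components `C₁` and `C₂` of `v` merge into one component, and the remainders of `D₁` and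
`D₂` are unconnected to it and to each other; only the factor of `C₁ ∪ C₂` needs the clique case. -/
theorem IsGluedAt.inducedSeries_of_simplicial [Finite V] {D₁ D₂ : Set V} {v : V} (h : IsGluedAt G D₁ D₂ v)
    (s₁ : ∀ u ∈ D₁, IsSimplicialIn G D₁ u) (s₂ : ∀ u ∈ D₂, IsSimplicialIn G D₂ u) :
    inducedSeries K G (D₁ ∪ D₂) =
      (1 - PowerSeries.X) ^ 2 * inducedSeries K G D₁ * inducedSeries K G D₂ := by
  set C₁ := closedNeighbors G D₁ v
  set C₂ := closedNeighbors G D₂ v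
  have m₁ : v ∈ C₁ := ⟨h.mem_left, Or.inl rfl⟩
  have m₂ : v ∈ C₂ := ⟨h.mem_right, Or.inl rfl⟩
  have hC : IsGluedAt G C₁ C₂ v :=
    ((h.subset_left closedNeighbors_subset m₁).symm.subset_left closedNeighbors_subset m₂).symm
  have e : D₁ ∪ D₂ = (C₁ ∪ C₂) ∪ (D₁ \ C₁ ∪ D₂ \ C₂) := by
    rw [Set.union_union_union_comm, Set.union_sdiff_cancel closedNeighbors_subset,
      Set.union_sdiff_cancel closedNeighbors_subset]
  have cross : ∀ {E₁ E₂ : Set V}, IsGluedAt G E₁ E₂ v → ∀ i ∈ closedNeighbors G E₁ v,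
      ∀ j ∈ E₂ \ closedNeighbors G E₂ v, i ≠ j ∧ ¬ G.Adj i j := by
    intro E₁ E₂ hE i hi j hj
    have hjv : j ≠ v := fun h' => hj.2 ⟨hj.1, Or.inl h'⟩
    refine ⟨fun h' => hjv (hE.eq_of_mem (h' ▸ hi.1) hj.1), fun hij => ?_⟩
    by_cases hiv : i = v
    · subst hiv
      exact hj.2 ⟨hj.1, Or.inr hij⟩
    · exact hE.not_adj i hi.1 j hj.1 hiv hjv hij
  have hv₁ : ∀ i ∈ D₁ \ C₁, i ≠ v := fun i hi h' => hi.2 (h' ▸ m₁)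
  have hv₂ : ∀ i ∈ D₂ \ C₂, i ≠ v := fun i hi h' => hi.2 (h' ▸ m₂)
  rw [e, inducedSeries_union (D₁ := C₁ ∪ C₂), inducedSeries_union (D₁ := D₁ \ C₁),
    hC.inducedSeries_of_isClique_of_isClique (isClique_closedNeighbors (s₁ v h.mem_left))
      (isClique_closedNeighbors (s₂ v h.mem_right)),
    inducedSeries_eq_closedNeighbors_mul s₁ h.mem_left,
    inducedSeries_eq_closedNeighbors_mul s₂ h.mem_right]
  · ring
  · exact Set.disjoint_left.2 fun i hi hi' => hv₁ i hi (h.eq_of_mem hi.1 hi'.1)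
  · exact fun i hi j hj => h.not_adj i hi.1 j hj.1 (hv₁ i hi) (hv₂ j hj)
  · rw [Set.disjoint_left]
    rintro i (hi | hi) (hi' | hi')
    · exact hi'.2 hi
    · exact (cross h i hi i hi').1 rfl
    · exact (cross h.symm i hi i hi').1 rfl
    · exact hi'.2 hi
  · rintro i (hi | hi) j (hj | hj)
    · exact not_adj_of_mem_closedNeighbors s₁ h.mem_left hi hj
    · exact (cross h i hi j hj).2
    · exact (cross h.symm i hi j hj).2
    · exact not_adj_of_mem_closedNeighbors s₂ h.mem_right hi hj

/-- The Hilbert series of a graph glued at a free vertex. -/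
theorem IsGluedAt.inducedSeries_eq [Finite V] {G : SimpleGraph V} {D₁ D₂ : Set V} {v : V}
    (h : IsGluedAt G D₁ D₂ v) :
    inducedSeries K G (D₁ ∪ D₂) =
      (1 - PowerSeries.X) ^ 2 * inducedSeries K G D₁ * inducedSeries K G D₂ := by
  induction hn : nonAdjCount G (D₁ ∪ D₂) using Nat.strong_induction_on generalizing G D₁ D₂ with
  | _ n ih =>
    subst hn
    -- The induction measure sees only the union, so this step serves both parts, with their roles
    -- exchanged.
    have step : ∀ {E₁ E₂ : Set V}, E₁ ∪ E₂ = D₁ ∪ D₂ → IsGluedAt G E₁ E₂ v → ∀ u ∈ E₁,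
        ¬ IsSimplicialIn G E₁ u → inducedSeries K G (E₁ ∪ E₂) =
          (1 - PowerSeries.X) ^ 2 * inducedSeries K G E₁ * inducedSeries K G E₂ := by
      intro E₁ E₂ hE hg u hu hs
      have huv : u ≠ v := fun h' => hs (h' ▸ hg.left)
      have hlt : E₁ \ {u} ∪ E₂ ⊂ E₁ ∪ E₂ := by
        refine (Set.ssubset_iff_of_subset (Set.union_subset_union_left _ Set.sdiff_subset)).2
          ⟨u, Or.inl hu, ?_⟩
        rintro (h' | h')
        · exact h'.2 rfl
        · exact huv (hg.eq_of_mem hu h')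
      have hv : v ∈ E₁ \ {u} := ⟨hg.mem_left, huv.symm⟩
      refine hg.inducedSeries_of_completeAt hu huv
        (ih _ ?_ (hg.completeAt hu huv) rfl)
        (ih _ ?_ (hg.subset_left Set.sdiff_subset hv) rfl)
        (ih _ ?_ ((hg.completeAt hu huv).subset_left Set.sdiff_subset hv) rfl)
      · rw [← hE]
        exact nonAdjCount_completeAt_lt fun h' => hs (h'.mono Set.subset_union_left)
      · rw [← hE]
        exact nonAdjCount_lt_of_ssubset hlt
      · rw [← hE]
        exact (nonAdjCount_completeAt_le _ _).trans_lt (nonAdjCount_lt_of_ssubset hlt)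
    by_cases s₁ : ∀ u ∈ D₁, IsSimplicialIn G D₁ u
    · by_cases s₂ : ∀ u ∈ D₂, IsSimplicialIn G D₂ u
      · exact h.inducedSeries_of_simplicial s₁ s₂
      · simp only [not_forall] at s₂
        obtain ⟨u, hu, hs⟩ := s₂
        rw [Set.union_comm, step (Set.union_comm _ _) h.symm u hu hs]
        ring
    · simp only [not_forall] at s₁
      obtain ⟨u, hu, hs⟩ := s₁
      exact step rfl h u hu hs

end Gluing

end BinomialEdge

namespace BinomialEdge

/-! ### Krull dimension as growth exponent -/

section KrullDimension

/-- Incomparability makes contraction of primes strictly monotone; lying over and going up lift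
chains. -/
theorem ringKrullDim_eq_of_isIntegral {R A : Type*} [CommRing R] [CommRing A] [Algebra R A]
    [Algebra.IsIntegral R A] (h : Function.Injective (algebraMap R A)) :
    ringKrullDim A = ringKrullDim R := by
  apply le_antisymm
  · refine Order.krullDim_le_of_strictMono (PrimeSpectrum.comap (algebraMap R A)) ?_
    intro P Q hPQ
    exact Ideal.IsIntegral.comap_lt_comap (I := P.asIdeal) (J := Q.asIdeal) hPQ
  · refine iSup_le fun l => ?_
    obtain ⟨Q, -, hQ, hQl⟩ := Ideal.exists_ideal_over_prime_of_isIntegral l.head.asIdeal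
      (⊥ : Ideal A) (by
        intro x hx
        have hx0 : x = 0 := h (by simpa using hx)
        rw [hx0]
        exact zero_mem _)
    have : Q.LiesOver l.head.asIdeal := ⟨hQl.symm⟩
    obtain ⟨L, hL, -⟩ := Ideal.exists_ltSeries_of_hasGoingUp l Q
    rw [← hL]
    exact Order.LTSeries.length_le_krullDim L

open MvPolynomial

variable {σ K : Type*} [Field K]

/-- Lifting the images of the `s` variables to polynomials, the sum of their degrees bounds the
degree growth; the added `1` makes `a` positive. -/
theorem exists_finrank_lower_bound {A : Type*} [CommRing A] [Algebra K A] {s : ℕ}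
    (φ : MvPolynomial σ K →ₐ[K] A) (hφ : Function.Surjective φ)
    (g : MvPolynomial (Fin s) K →ₐ[K] A) :
    ∃ a, 0 < a ∧ ∀ (k : ℕ) (m : Fin s →₀ ℕ), (∀ j, m j ≤ k) →
      ∃ p : MvPolynomial σ K, p.totalDegree ≤ a * k ∧ φ p = g (monomial m 1) := by
  choose z hz using fun j => hφ (g (X j))
  refine ⟨∑ j, (z j).totalDegree + 1, Nat.succ_pos _, fun k m hm => ?_⟩
  refine ⟨∏ j, z j ^ m j, ?_, ?_⟩
  · calc (∏ j, z j ^ m j).totalDegree ≤ ∑ j, (z j ^ m j).totalDegree :=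
          totalDegree_finsetProd _ _
      _ ≤ ∑ j, (z j).totalDegree * k := Finset.sum_le_sum fun j _ => by
          refine (totalDegree_pow _ _).trans ?_
          rw [mul_comm]
          exact Nat.mul_le_mul_left _ (hm j)
      _ ≤ _ := by
          rw [← Finset.sum_mul]
          exact Nat.mul_le_mul_right _ (Nat.le_succ _)
  · rw [map_prod, algHom_monomial, Finsupp.prod_fintype _ _ (by simp)]
    simp [hz]

/-- The span of the images of the monomials with exponents at most `a`. -/
noncomputable def boxSpan {A : Type*} [CommRing A] [Algebra K A] {s : ℕ}
    (g : MvPolynomial (Fin s) K →ₐ[K] A) (a : ℕ) : Submodule K A :=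
  Submodule.span K (Set.range fun e : Fin s → Fin (a + 1) =>
    g (monomial (Finsupp.equivFunOnFinite.symm fun j => (e j : ℕ)) 1))

section Box

variable {A : Type*} [CommRing A] [Algebra K A] {s : ℕ} (g : MvPolynomial (Fin s) K →ₐ[K] A)

theorem monomial_mem_boxSpan {a : ℕ} {m : Fin s →₀ ℕ} (hm : ∀ j, m j ≤ a) :
    g (monomial m 1) ∈ boxSpan g a := by
  refine Submodule.subset_span ⟨fun j => ⟨m j, Nat.lt_succ_of_le (hm j)⟩, ?_⟩
  have : (Finsupp.equivFunOnFinite.symm fun j => m j) = m := by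
    ext j
    simp
  simp only [this]

theorem boxSpan_mono {a b : ℕ} (h : a ≤ b) : boxSpan g a ≤ boxSpan g b := by
  refine Submodule.span_le.2 ?_
  rintro _ ⟨e, rfl⟩
  refine monomial_mem_boxSpan g fun j => ?_
  have := (e j).2
  simp only [Finsupp.equivFunOnFinite_symm_apply_apply]
  omega

theorem boxSpan_mul_le (a b : ℕ) : boxSpan g a * boxSpan g b ≤ boxSpan g (a + b) := by
  rw [boxSpan, boxSpan, Submodule.span_mul_span, Submodule.span_le]
  rintro _ ⟨_, ⟨e, rfl⟩, _, ⟨e', rfl⟩, rfl⟩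
  simp only [← map_mul, monomial_mul, one_mul]
  refine monomial_mem_boxSpan g fun j => ?_
  have := (e j).2
  have := (e' j).2
  simp only [Finsupp.add_apply, Finsupp.equivFunOnFinite_symm_apply_apply]
  omega

theorem exists_mem_boxSpan (p : MvPolynomial (Fin s) K) : ∃ a, g p ∈ boxSpan g a := by
  refine ⟨p.totalDegree, ?_⟩
  rw [p.as_sum, map_sum]
  refine Submodule.sum_mem _ fun m hm => ?_
  have e1 : monomial m (coeff m p) = coeff m p • monomial m (1 : K) := by
    simp [smul_monomial]
  rw [e1, map_smul]
  refine Submodule.smul_mem _ _ (monomial_mem_boxSpan g fun j => ?_)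
  have h1 := le_totalDegree hm
  rw [← p.as_sum]
  refine le_trans ?_ h1
  rw [Finsupp.sum_fintype _ _ (by simp)]
  exact Finset.single_le_sum (f := fun j => m j) (fun _ _ => Nat.zero_le _) (Finset.mem_univ j)

theorem mem_mul_of_le {M M' N : Submodule K A} (h : M ≤ M') {x : A} (hx : x ∈ M * N) :
    x ∈ M' * N :=
  mul_le_mul' h le_rfl hx

theorem exists_fin_generators (hg : g.Finite) : ∃ (q : ℕ) (r : Fin q → A),
    ∀ y, ∃ p : Fin q → MvPolynomial (Fin s) K, y = ∑ b, g (p b) * r b := by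
  let _ : Algebra (MvPolynomial (Fin s) K) A := g.toRingHom.toAlgebra
  have hfin : Module.Finite (MvPolynomial (Fin s) K) A := hg
  obtain ⟨q, r, hr⟩ := Module.Finite.exists_fin (R := MvPolynomial (Fin s) K) (M := A)
  refine ⟨q, r, fun y => ?_⟩
  have hy : y ∈ Submodule.span (MvPolynomial (Fin s) K) (Set.range r) := by
    rw [hr]
    trivial
  obtain ⟨p, hp⟩ := (Submodule.mem_span_range_iff_exists_fun _).1 hy
  exact ⟨p, hp.symm⟩

theorem exists_mem_boxSpan_mul {q : ℕ} (r : Fin q → A)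
    (hr : ∀ y, ∃ p : Fin q → MvPolynomial (Fin s) K, y = ∑ b, g (p b) * r b) (y : A) :
    ∃ a, y ∈ boxSpan g a * Submodule.span K (Set.range r) := by
  obtain ⟨p, rfl⟩ := hr y
  choose a ha using fun b => exists_mem_boxSpan g (p b)
  refine ⟨∑ b, a b, Submodule.sum_mem _ fun b _ => Submodule.mul_mem_mul ?_
    (Submodule.subset_span ⟨b, rfl⟩)⟩
  exact boxSpan_mono g (Finset.single_le_sum (f := a) (fun _ _ => Nat.zero_le _)
    (Finset.mem_univ b)) (ha b)

/-- With `N` the span of the generators `r`, one constant `c` satisfies `1 ∈ boxSpan g c * N` and `φ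
(X i) * N ≤ boxSpan g c * N` for all `i`. Each variable factor thus enlarges the box by `c`, and the
start costs another `c`. -/
theorem exists_mem_boxSpan_of_totalDegree_le [Finite σ] (φ : MvPolynomial σ K →ₐ[K] A) {q : ℕ}
    (r : Fin q → A)
    (hr : ∀ y, ∃ p : Fin q → MvPolynomial (Fin s) K, y = ∑ b, g (p b) * r b) :
    ∃ c, ∀ m : σ →₀ ℕ,
      φ (monomial m 1) ∈ boxSpan g (c * (m.degree + 1)) * Submodule.span K (Set.range r) := by
  classical
  have := Fintype.ofFinite σ
  set N := Submodule.span K (Set.range r) with hN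
  choose a ha using exists_mem_boxSpan_mul g r hr
  let c := a 1 + ∑ i, ∑ b, a (φ (X i) * r b)
  have h1 : (1 : A) ∈ boxSpan g c * N :=
    mem_mul_of_le (boxSpan_mono g (Nat.le_add_right _ _)) (ha 1)
  have hX : ∀ i, Submodule.span K {φ (X i)} * N ≤ boxSpan g c * N := by
    intro i
    rw [hN, Submodule.span_mul_span, Submodule.span_le]
    rintro _ ⟨x, hx, _, ⟨b, rfl⟩, rfl⟩
    obtain rfl : x = φ (X i) := hx
    refine mem_mul_of_le (boxSpan_mono g ?_) (ha (φ (X i) * r b))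
    refine le_trans ?_ (Nat.le_add_left _ _)
    refine le_trans ?_ (Finset.single_le_sum (f := fun i => ∑ b, a (φ (X i) * r b))
      (fun _ _ => Nat.zero_le _) (Finset.mem_univ i))
    exact Finset.single_le_sum (f := fun b => a (φ (X i) * r b))
      (fun _ _ => Nat.zero_le _) (Finset.mem_univ b)
  have key : ∀ M : Multiset σ, φ ((M.map X).prod) ∈ boxSpan g (c * (M.card + 1)) * N := by
    intro M
    induction M using Multiset.induction_on with
    | empty => simpa using h1
    | cons i M ih =>
      rw [Multiset.map_cons, Multiset.prod_cons, map_mul, Multiset.card_cons]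
      have h2 := Submodule.mul_mem_mul (Submodule.mem_span_singleton_self (R := K) (φ (X i))) ih
      rw [mul_left_comm] at h2
      have h3 := mul_le_mul' (le_refl (boxSpan g (c * (M.card + 1)))) (hX i) h2
      rw [← mul_assoc] at h3
      refine mem_mul_of_le ?_ h3
      exact (boxSpan_mul_le g _ _).trans (boxSpan_mono g (by ring_nf; rfl))
  refine ⟨c, fun m => ?_⟩
  have h2 := key (Finsupp.toMultiset m)
  rw [prod_map_X, Finsupp.toMultiset_toFinsupp, Finsupp.card_toMultiset] at h2
  exact h2

open scoped Pointwise in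
theorem finrank_boxSpan_mul_le (a : ℕ) {q : ℕ} (r : Fin q → A) :
    Module.Finite K ↥(boxSpan g a * Submodule.span K (Set.range r)) ∧
    Module.finrank K ↥(boxSpan g a * Submodule.span K (Set.range r)) ≤ q * (a + 1) ^ s := by
  rw [boxSpan, Submodule.span_mul_span]
  have e : ((Set.range fun e : Fin s → Fin (a + 1) =>
      g (monomial (Finsupp.equivFunOnFinite.symm fun j => (e j : ℕ)) 1)) * Set.range r) =
      Set.range fun x : (Fin s → Fin (a + 1)) × Fin q =>
        g (monomial (Finsupp.equivFunOnFinite.symm fun j => (x.1 j : ℕ)) 1) * r x.2 := by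
    ext y
    simp [Set.mem_mul]
  rw [e]
  refine ⟨Module.Finite.span_of_finite K (Set.finite_range _), ?_⟩
  refine (finrank_range_le_card _).trans ?_
  simp [mul_comm]

end Box

/-- The sum of the Hilbert function in degrees at most `k`. -/
noncomputable def cumulativeHilbertFunction (I : Ideal (MvPolynomial σ K)) (k : ℕ) : ℕ :=
  ∑ i ∈ Finset.range (k + 1), hilbertFunction I i

theorem card_le_eq_sum {ι : Type*} (d : ι → ℕ) [∀ k, Finite {i // d i = k}] (k : ℕ) :
    Finite {i // d i ≤ k} ∧
    Nat.card {i // d i ≤ k} = ∑ j ∈ Finset.range (k + 1), Nat.card {i // d i = j} := by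
  let E : {i // d i ≤ k} ≃ Σ j : Finset.range (k + 1), {i // d i = j.1} :=
    { toFun := fun x => ⟨⟨d x.1, Finset.mem_range.2 (Nat.lt_succ_of_le x.2)⟩, x.1, rfl⟩
      invFun := fun y => ⟨y.2.1, by
        rw [y.2.2]; exact Nat.le_of_lt_succ (Finset.mem_range.1 y.1.2)⟩
      left_inv := fun x => rfl
      right_inv := by
        rintro ⟨⟨j, h⟩, ⟨i, hi⟩⟩
        dsimp only at hi
        subst hi
        rfl }
  refine ⟨Finite.of_equiv _ E.symm, ?_⟩
  rw [Nat.card_congr E, Nat.card_sigma]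
  exact Finset.sum_coe_sort (Finset.range (k + 1)) (fun j => Nat.card {i // d i = j})

/-- The cumulative Hilbert function grows like a power whose exponent is the Krull dimension. -/
theorem exists_ringKrullDim_eq_and_bounds [Finite σ] {I : Ideal (MvPolynomial σ K)}
    (hI : IsGradedIdeal I) (hne : I ≠ ⊤) :
    ∃ s : ℕ, ringKrullDim (MvPolynomial σ K ⧸ I) = s ∧
      (∃ a, 0 < a ∧ ∀ k, (k + 1) ^ s ≤ cumulativeHilbertFunction I (a * k)) ∧
      ∃ c q, ∀ k, cumulativeHilbertFunction I k ≤ q * (c * (k + 1) + 1) ^ s := by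
  have : Nontrivial (MvPolynomial σ K ⧸ I) := Ideal.Quotient.nontrivial_iff.2 hne
  -- Noether normalization: the number `s` of variables is the Krull dimension, since the extension
  -- is integral.
  obtain ⟨s, g, hg, hfin⟩ := exists_finite_inj_algHom_of_fg K (MvPolynomial σ K ⧸ I)
  obtain ⟨b, li, sp⟩ := exists_homogeneous_basis hI
  have fb : ∀ k, Finite {i : b // i.1.degree = k} := fun k =>
    finite_of_linearIndependent _ (fun i : b => i.1.degree)
      (fun i => isHomogeneous_monomial _ rfl) li k
  have hf : ∀ k, hilbertFunction I k = Nat.card {i : b // i.1.degree = k} := fun k =>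
    hilbertFunction_eq_card _ (fun i : b => i.1.degree)
      (fun i => isHomogeneous_monomial _ rfl) li k (sp k)
  have hc : ∀ k, cumulativeHilbertFunction I k = Nat.card {i : b // i.1.degree ≤ k} := by
    intro k
    rw [(card_le_eq_sum (fun i : b => i.1.degree) k).2]
    exact Finset.sum_congr rfl fun i _ => hf i
  have fle : ∀ k, Finite {i : b // i.1.degree ≤ k} := fun k =>
    (card_le_eq_sum (fun i : b => i.1.degree) k).1
  have lile : ∀ k, LinearIndependent K fun i : {i : b // i.1.degree ≤ k} =>
      Ideal.Quotient.mk I (monomial i.1.1 (1 : K)) := fun k =>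
    li.comp _ Subtype.val_injective
  refine ⟨s, ?_, ?_, ?_⟩
  · let _ : Algebra (MvPolynomial (Fin s) K) (MvPolynomial σ K ⧸ I) := g.toRingHom.toAlgebra
    have hint : Algebra.IsIntegral (MvPolynomial (Fin s) K) (MvPolynomial σ K ⧸ I) :=
      ⟨RingHom.Finite.to_isIntegral (f := g.toRingHom) hfin⟩
    rw [ringKrullDim_eq_of_isIntegral (R := MvPolynomial (Fin s) K) hg,
      MvPolynomial.ringKrullDim_of_isNoetherianRing, ringKrullDim_eq_zero_of_field]
    simp
  · obtain ⟨a, ha, h⟩ := exists_finrank_lower_bound (Ideal.Quotient.mkₐ K I)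
      (Ideal.Quotient.mkₐ_surjective K I) g
    refine ⟨a, ha, fun k => ?_⟩
    let F := Submodule.span K (Set.range fun i : {i : b // i.1.degree ≤ a * k} =>
      Ideal.Quotient.mk I (monomial i.1.1 (1 : K)))
    have hF : ∀ p : MvPolynomial σ K, p.totalDegree ≤ a * k → Ideal.Quotient.mk I p ∈ F := by
      intro p hp
      rw [← sum_homogeneousComponent p, map_sum]
      refine Submodule.sum_mem _ fun i hi => ?_
      have hi' : i ≤ a * k := (Nat.le_of_lt_succ (Finset.mem_range.1 hi)).trans hp
      refine Submodule.span_mono ?_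
        (sp i ⟨_, homogeneousComponent_isHomogeneous i p, rfl⟩)
      rintro _ ⟨j, hj, rfl⟩
      have hj' : j.1.degree = i := hj
      exact ⟨⟨j, hj'.trans_le hi'⟩, rfl⟩
    have hFr : Module.finrank K F = cumulativeHilbertFunction I (a * k) := by
      rw [hc]
      exact Module.finrank_eq_nat_card_basis (Module.Basis.span (lile (a * k)))
    have hFf : Module.Finite K F := Module.Finite.span_of_finite K (Set.finite_range _)
    -- The `(k + 1) ^ s` monomials of the box stay independent under the injective `g` and land in
    -- the span of degrees at most `a * k`.
    let exps : (Fin s → Fin (k + 1)) → (Fin s →₀ ℕ) := fun e =>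
      Finsupp.equivFunOnFinite.symm fun j => (e j : ℕ)
    have hexps : Function.Injective exps := by
      intro e e' h
      funext j
      have := DFunLike.congr_fun h j
      simpa [exps, Fin.ext_iff] using this
    let v : (Fin s → Fin (k + 1)) → F := fun e => ⟨g (monomial (exps e) 1), by
      obtain ⟨p, hp, hpe⟩ := h k (exps e) (fun j => by
        simpa [exps] using Nat.le_of_lt_succ (e j).2)
      rw [← hpe]
      exact hF p hp⟩
    have hv : LinearIndependent K v := by
      apply LinearIndependent.of_comp F.subtype
      have h1 : LinearIndependent K fun e => monomial (exps e) (1 : K) := by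
        have := (basisMonomials (Fin s) K).linearIndependent.comp exps hexps
        rw [coe_basisMonomials] at this
        exact this
      exact h1.map' g.toLinearMap (LinearMap.ker_eq_bot.2 hg)
    have := hv.fintype_card_le_finrank
    rw [hFr] at this
    simpa using this
  -- Conversely, basis monomials of degree at most `k` lie in the span of products of box monomials
  -- with `q` module generators.
  · obtain ⟨q, r, hr'⟩ := exists_fin_generators g hfin
    obtain ⟨c, h⟩ := exists_mem_boxSpan_of_totalDegree_le g (Ideal.Quotient.mkₐ K I) r hr'
    refine ⟨c, q, fun k => ?_⟩
    obtain ⟨h1, h2⟩ := finrank_boxSpan_mul_le g (c * (k + 1)) r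
    refine le_trans ?_ h2
    let v : {i : b // i.1.degree ≤ k} →
        ↥(boxSpan g (c * (k + 1)) * Submodule.span K (Set.range r)) := fun i =>
      ⟨Ideal.Quotient.mk I (monomial i.1.1 (1 : K)), mem_mul_of_le
        (boxSpan_mono g (Nat.mul_le_mul_left c (Nat.succ_le_succ i.2))) (h i.1.1)⟩
    have hv : LinearIndependent K v := LinearIndependent.of_comp
      (boxSpan g (c * (k + 1)) * Submodule.span K (Set.range r)).subtype (lile k)
    have := Fintype.ofFinite {i : b // i.1.degree ≤ k}
    rw [hc, Nat.card_eq_fintype_card]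
    exact hv.fintype_card_le_finrank

end KrullDimension

end BinomialEdge

namespace BinomialEdge

open Filter

/-! ### Reading dimension and multiplicity off the Hilbert series -/

section Asymptotics

/-- Otherwise `B / A` would tend to zero, while it is eventually at least one. -/
theorem natDegree_le_of_eval_le {A B : Polynomial ℚ}
    (h : ∀ᶠ k : ℕ in atTop, 0 < A.eval (k : ℚ) ∧ A.eval (k : ℚ) ≤ B.eval (k : ℚ)) :
    A.natDegree ≤ B.natDegree := by
  by_contra hlt
  have hdeg : B.degree < A.degree := Polynomial.degree_lt_degree (not_le.1 hlt)
  have ht := (Polynomial.div_tendsto_atTop_zero_of_degree_lt B A hdeg).comp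
    (tendsto_natCast_atTop_atTop (R := ℚ))
  have h1 := ht.eventually (eventually_lt_nhds (zero_lt_one (α := ℚ)))
  obtain ⟨k, hk, h0, hle⟩ := (h1.and h).exists
  rw [Function.comp_apply, div_lt_one h0] at hk
  exact absurd hle (not_le.2 hk)

variable {σ K : Type*} [Field K]

theorem cumulativeHilbertFunction_eq_coeff (I : Ideal (MvPolynomial σ K)) (k : ℕ) :
    (cumulativeHilbertFunction I k : ℤ) =
      PowerSeries.coeff k (hilbertSeries I * PowerSeries.mk 1) := by
  rw [PowerSeries.coeff_mul, Finset.Nat.sum_antidiagonal_eq_sum_range_succ_mk,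
    cumulativeHilbertFunction]
  simp [hilbertSeries]

/-- Partial sums multiply the series by `1 / (1 - X)`, whence `d + 1` in place of `d`. -/
theorem eventually_cumulativeHilbertFunction {I : Ideal (MvPolynomial σ K)} {d : ℕ}
    {Q : Polynomial ℤ} (hQ : (1 - PowerSeries.X) ^ d * hilbertSeries I = (Q : PowerSeries ℤ)) :
    ∀ᶠ k : ℕ in atTop, (cumulativeHilbertFunction I k : ℚ) =
      (Polynomial.hilbertPoly (Q.map (Int.castRingHom ℚ)) (d + 1)).eval (k : ℚ) := by
  filter_upwards [eventually_gt_atTop (Q.map (Int.castRingHom ℚ)).natDegree] with k hk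
  rw [← Polynomial.coeff_mul_invOneSubPow_eq_hilbertPoly_eval (d + 1) hk]
  have h1 : PowerSeries.map (Int.castRingHom ℚ) (hilbertSeries I * PowerSeries.mk 1) =
      (Q.map (Int.castRingHom ℚ) : PowerSeries ℚ) * (PowerSeries.invOneSubPow ℚ (d + 1)).val := by
    have h2 := congrArg (PowerSeries.map (Int.castRingHom ℚ)) hQ
    rw [map_mul, map_pow, map_sub, map_one, PowerSeries.map_X] at h2
    have h3 : PowerSeries.map (Int.castRingHom ℚ) (Q : PowerSeries ℤ) =
        (Q.map (Int.castRingHom ℚ) : PowerSeries ℚ) := by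
      ext n
      simp
    have h4 : PowerSeries.map (Int.castRingHom ℚ) (PowerSeries.mk 1) = PowerSeries.mk 1 := by
      ext n
      simp
    rw [← h3, ← h2, map_mul, h4, PowerSeries.invOneSubPow_add, Units.val_mul]
    have h5 : (1 - PowerSeries.X : PowerSeries ℚ) ^ d * (PowerSeries.invOneSubPow ℚ d).val = 1 := by
      rw [← PowerSeries.invOneSubPow_inv_eq_one_sub_pow]
      exact (PowerSeries.invOneSubPow ℚ d).inv_val
    have h6 : (PowerSeries.invOneSubPow ℚ 1).val = PowerSeries.mk 1 := by
      rw [PowerSeries.invOneSubPow_val_succ_eq_mk_add_choose]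
      ext n
      simp
    rw [h6]
    linear_combination -(PowerSeries.map (Int.castRingHom ℚ) (hilbertSeries I)) *
      PowerSeries.mk 1 * h5
  rw [← h1, PowerSeries.coeff_map, ← cumulativeHilbertFunction_eq_coeff]
  simp

/-- The Krull dimension is the order of the pole at one of the Hilbert series. -/
theorem ringKrullDim_eq_of_hilbertSeries [Finite σ] {I : Ideal (MvPolynomial σ K)}
    (hI : IsGradedIdeal I) (hne : I ≠ ⊤) {d : ℕ} {Q : Polynomial ℤ}
    (hQ : (1 - PowerSeries.X) ^ d * hilbertSeries I = (Q : PowerSeries ℤ)) (h1 : Q.eval 1 ≠ 0) :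
    ringKrullDim (MvPolynomial σ K ⧸ I) = d := by
  obtain ⟨s, hs, ⟨a, ha, hlow⟩, c, q, hup⟩ := exists_ringKrullDim_eq_and_bounds hI hne
  rw [hs]
  set Q' := Q.map (Int.castRingHom ℚ) with hQ'
  set P := Polynomial.hilbertPoly Q' (d + 1) with hP
  have hev : ∀ᶠ k : ℕ in atTop, (cumulativeHilbertFunction I k : ℚ) = P.eval (k : ℚ) :=
    eventually_cumulativeHilbertFunction hQ
  have hr : ¬ Q'.IsRoot 1 := by
    rw [Polynomial.IsRoot, hQ', show (1 : ℚ) = Int.castRingHom ℚ 1 by simp,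
      Polynomial.eval_map_apply]
    simpa using h1
  -- Since `Q(1) ≠ 0`, nothing cancels against the pole of order `d + 1`. Comparing this degree with
  -- the two growth bounds yields `s = d`.
  have hdeg : P.natDegree = d := by
    have hQ0 : Q' ≠ 0 := fun h => hr (by rw [h]; simp [Polynomial.IsRoot])
    have h0 : Q'.rootMultiplicity 1 = 0 := Polynomial.rootMultiplicity_eq_zero hr
    rw [hP, Polynomial.natDegree_hilbertPoly_of_ne_zero_of_rootMultiplicity_lt hQ0 (by omega), h0]
    omega
  have haq : (a : ℚ) ≠ 0 := by exact_mod_cast ha.ne'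
  have hta : Tendsto (fun k : ℕ => a * k) atTop atTop :=
    tendsto_id.const_mul_atTop' ha
  have le1 : s ≤ d := by
    have h := natDegree_le_of_eval_le (A := (Polynomial.X + 1) ^ s)
      (B := P.comp (Polynomial.C (a : ℚ) * Polynomial.X)) (by
        filter_upwards [hta.eventually hev] with k hk
        have e1 : ((Polynomial.X + 1 : Polynomial ℚ) ^ s).eval (k : ℚ) = ((k : ℚ) + 1) ^ s := by simp
        have e2 : (P.comp (Polynomial.C (a : ℚ) * Polynomial.X)).eval (k : ℚ) =
            (cumulativeHilbertFunction I (a * k) : ℚ) := by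
          rw [hk]
          simp
        rw [e1, e2]
        exact ⟨by positivity, by exact_mod_cast hlow k⟩)
    rw [Polynomial.natDegree_comp, Polynomial.natDegree_C_mul_X _ haq, mul_one, hdeg,
      Polynomial.natDegree_pow, show (Polynomial.X + 1 : Polynomial ℚ) =
        Polynomial.X + Polynomial.C 1 by simp, Polynomial.natDegree_X_add_C, mul_one] at h
    exact h
  have le2 : d ≤ s := by
    have h := natDegree_le_of_eval_le (A := P)
      (B := Polynomial.C (q : ℚ) * (Polynomial.C (c : ℚ) * Polynomial.X +
        Polynomial.C (c + 1 : ℚ)) ^ s) (by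
        filter_upwards [hev] with k hk
        have e2 : (Polynomial.C (q : ℚ) * (Polynomial.C (c : ℚ) * Polynomial.X +
            Polynomial.C (c + 1 : ℚ)) ^ s : Polynomial ℚ).eval (k : ℚ) = (q : ℚ) * (c * (k + 1) + 1) ^ s := by
          simp only [Polynomial.eval_mul, Polynomial.eval_C, Polynomial.eval_pow,
            Polynomial.eval_add, Polynomial.eval_X]
          ring
        rw [e2, ← hk]
        refine ⟨?_, by exact_mod_cast hup k⟩
        have h0 : 1 ≤ cumulativeHilbertFunction I 0 := by simpa using hlow 0
        have hmono : cumulativeHilbertFunction I 0 ≤ cumulativeHilbertFunction I k :=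
          Finset.sum_le_sum_of_subset (Finset.range_mono (by omega))
        exact_mod_cast h0.trans hmono)
    rw [hdeg] at h
    refine h.trans ((Polynomial.natDegree_C_mul_le _ _).trans
      ((Polynomial.natDegree_pow_le).trans ?_))
    exact (Nat.mul_le_mul_left s Polynomial.natDegree_linear_le).trans (by omega)
  have : s = d := le_antisymm le1 le2
  rw [this]

/-- For exponent `d + 1`, write `Q = Q(1) - (1 - X) R`. The constant contributes `Q(1) * binom(k +
d, d)`, which is the top term, and `-R` is the numerator of a series with exponent `d`. -/
theorem exists_sum_choose {d : ℕ} : ∀ {f : PowerSeries ℤ} {Q : Polynomial ℤ},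
    (1 - PowerSeries.X) ^ d * f = (Q : PowerSeries ℤ) → ∃ c : ℕ → ℤ,
      (∀ᶠ k : ℕ in atTop, PowerSeries.coeff k f =
        ∑ i ∈ Finset.range d, c i * ((k + i).choose i : ℤ)) ∧
      (0 < d → c (d - 1) = Q.eval 1) := by
  induction d with
  | zero =>
    intro f Q h
    refine ⟨0, ?_, fun h => absurd h (lt_irrefl 0)⟩
    filter_upwards [eventually_gt_atTop Q.natDegree] with k hk
    rw [pow_zero, one_mul] at h
    rw [h, Polynomial.coeff_coe, Polynomial.coeff_eq_zero_of_natDegree_lt hk]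
    simp
  | succ d ih =>
    intro f Q h
    obtain ⟨R, hR⟩ := Polynomial.dvd_iff_isRoot.2
      (show (Q - Polynomial.C (Q.eval 1)).IsRoot 1 by simp)
    have hU : (PowerSeries.mk fun n => ((d + n).choose d : ℤ)) * (1 - PowerSeries.X) ^ (d + 1) =
        1 := by
      exact_mod_cast PowerSeries.mk_add_choose_mul_one_sub_pow_eq_one ℤ d
    have hQ : (Q : PowerSeries ℤ) = PowerSeries.C (Q.eval 1) -
        (1 - PowerSeries.X) * (R : PowerSeries ℤ) := by
      have h2 : Q = Polynomial.C (Q.eval 1) - (1 - Polynomial.X) * R := by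
        rw [← sub_add_cancel Q (Polynomial.C (Q.eval 1)), hR]
        simp
        ring
      conv_lhs => rw [h2]
      rw [Polynomial.coe_sub, Polynomial.coe_mul, coe_one_sub_X, Polynomial.coe_C]
    obtain ⟨c, hc, -⟩ := ih (f := f - PowerSeries.C (Q.eval 1) *
      PowerSeries.mk fun n => ((d + n).choose d : ℤ)) (Q := -R) (by
        apply mul_left_cancel₀ one_sub_X_ne_zero
        rw [hQ] at h
        rw [Polynomial.coe_neg]
        linear_combination h - PowerSeries.C (Q.eval 1) * hU)
    refine ⟨fun i => if i = d then Q.eval 1 else c i, ?_, fun _ => by simp⟩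
    filter_upwards [hc] with k hk
    rw [Finset.sum_range_succ, map_sub, PowerSeries.coeff_C_mul, PowerSeries.coeff_mk,
      sub_eq_iff_eq_add] at *
    rw [hk, if_pos rfl, add_comm d k]
    congr 1
    refine Finset.sum_congr rfl fun i hi => ?_
    rw [if_neg (Finset.mem_range.1 hi).ne]

theorem isMultiplicity_of_hilbertSeries {I : Ideal (MvPolynomial σ K)} {d : ℕ} {Q : Polynomial ℤ}
    (hd : 0 < d) (hdim : ringKrullDim (MvPolynomial σ K ⧸ I) = d)
    (hQ : (1 - PowerSeries.X) ^ d * hilbertSeries I = (Q : PowerSeries ℤ)) :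
    IsMultiplicity I (Q.eval 1) := by
  obtain ⟨c, hc, hc0⟩ := exists_sum_choose hQ
  -- The sign and the reversal of indices cancel those in `HasHilbertCoefficients`.
  refine ⟨d, hd, hdim, fun j => (-1) ^ j * c (d - 1 - j), ?_, by simpa using hc0 hd⟩
  filter_upwards [hc] with k hk
  rw [hilbertSeries, PowerSeries.coeff_mk] at hk
  rw [hk]
  refine Finset.sum_congr rfl fun i hi => ?_
  have hi' := Finset.mem_range.1 hi
  rw [show d - 1 - (d - 1 - i) = i by omega, ← mul_assoc, ← mul_pow]
  simp

/-- For the least exponent that clears the denominator, `Q(1) = 0` would allow a factor `1 - X` to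
be cancelled. The exponent is positive since a polynomial has only finitely many nonzero
coefficients. -/
theorem IsHilbertRational.exists_pos {f : PowerSeries ℤ} (hf : IsHilbertRational f)
    (h : ∀ k, PowerSeries.coeff k f ≠ 0) :
    ∃ (d : ℕ) (Q : Polynomial ℤ), 0 < d ∧ (1 - PowerSeries.X) ^ d * f = (Q : PowerSeries ℤ) ∧
      Q.eval 1 ≠ 0 := by
  classical
  have hf' : ∃ N, ∃ P : Polynomial ℤ, (1 - PowerSeries.X) ^ N * f = (P : PowerSeries ℤ) := hf
  obtain ⟨Q, hQ⟩ := Nat.find_spec hf'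
  have hpos : 0 < Nat.find hf' := by
    by_contra h0
    rw [Nat.eq_zero_of_not_pos h0, pow_zero, one_mul] at hQ
    apply h (Q.natDegree + 1)
    rw [hQ, Polynomial.coeff_coe, Polynomial.coeff_eq_zero_of_natDegree_lt (Nat.lt_succ_self _)]
  refine ⟨Nat.find hf', Q, hpos, hQ, fun h1 => ?_⟩
  obtain ⟨R, rfl⟩ := Polynomial.dvd_iff_isRoot.2 (show Q.IsRoot 1 from h1)
  refine Nat.find_min hf' (m := Nat.find hf' - 1) (by omega) ⟨-R, ?_⟩
  apply mul_left_cancel₀ one_sub_X_ne_zero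
  rw [← mul_assoc, ← pow_succ', Nat.sub_add_cancel hpos, hQ, Polynomial.coe_mul,
    Polynomial.coe_sub, Polynomial.coe_X, Polynomial.coe_C, Polynomial.coe_neg]
  simp
  ring

end Asymptotics

/-! ### Back to graphs, subgraphs and decompositions -/

section Graph

open MvPolynomial

variable {V : Type*} (K : Type*) [Field K]

/-- The point with all `x_i = 1` and all `y_i = 0` is a zero of every edge binomial. The exponent
`0` also shows that the ideal is proper. -/
theorem X_pow_notMem_binomialEdgeIdeal (G : SimpleGraph V) (v : V) (k : ℕ) :
    (X (Sum.inl v) : MvPolynomial (V ⊕ V) K) ^ k ∉ binomialEdgeIdeal K G := by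
  let f : MvPolynomial (V ⊕ V) K →ₐ[K] K := aeval (Sum.elim (fun _ => 1) (fun _ => 0))
  have hle : binomialEdgeIdeal K G ≤ RingHom.ker f := by
    refine Ideal.span_le.2 ?_
    rintro _ ⟨i, j, -, rfl⟩
    simp [f, RingHom.mem_ker]
  intro h
  have := hle h
  simp [f, RingHom.mem_ker] at this

theorem hilbertFunction_binomialEdgeIdeal_ne_zero [Finite V] [Nonempty V] (G : SimpleGraph V)
    (k : ℕ) : hilbertFunction (binomialEdgeIdeal K G) k ≠ 0 := by
  obtain ⟨v⟩ := ‹Nonempty V›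
  intro h
  have hbot := Submodule.finrank_eq_zero.1 h
  have hmem : Ideal.Quotient.mk (binomialEdgeIdeal K G) (X (Sum.inl v) ^ k) ∈
      gradedPart (binomialEdgeIdeal K G) k :=
    ⟨_, isHomogeneous_X_pow _ _, rfl⟩
  rw [hbot, Submodule.mem_bot, Ideal.Quotient.eq_zero_iff_mem] at hmem
  exact X_pow_notMem_binomialEdgeIdeal K G v k hmem

theorem edgeDim_and_isMultiplicity [Finite V] [Nonempty V] (G : SimpleGraph V) {d : ℕ}
    {Q : Polynomial ℤ} (hd : 0 < d)
    (hQ : (1 - PowerSeries.X) ^ d * hilbertSeries (binomialEdgeIdeal K G) = (Q : PowerSeries ℤ))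
    (h1 : Q.eval 1 ≠ 0) :
    edgeDim K G = d ∧ IsMultiplicity (binomialEdgeIdeal K G) (Q.eval 1) := by
  have hdim : edgeDim K G = d := by
    refine ringKrullDim_eq_of_hilbertSeries ?_ ?_ hQ h1
    · rw [← inducedIdeal_univ]
      exact isGradedIdeal_inducedIdeal
    · intro htop
      obtain ⟨v⟩ := ‹Nonempty V›
      refine X_pow_notMem_binomialEdgeIdeal K G v 0 ?_
      rw [htop]
      trivial
  exact ⟨hdim, isMultiplicity_of_hilbertSeries hd hdim hQ⟩

theorem exists_hilbertSeries_eq [Finite V] [Nonempty V] (G : SimpleGraph V) :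
    ∃ (d : ℕ) (Q : Polynomial ℤ), 0 < d ∧
      (1 - PowerSeries.X) ^ d * hilbertSeries (binomialEdgeIdeal K G) = (Q : PowerSeries ℤ) ∧
      Q.eval 1 ≠ 0 := by
  have h := isHilbertRational_inducedSeries (K := K) G Set.univ
  rw [inducedSeries, inducedIdeal_univ] at h
  refine h.exists_pos fun k => ?_
  rw [hilbertSeries, PowerSeries.coeff_mk]
  exact_mod_cast hilbertFunction_binomialEdgeIdeal_ne_zero K G k

/-- The dimension and the multiplicity follow from the formula for the Hilbert series. -/
theorem dim_and_multiplicity_of_hilbertSeries_eq {V₁ V₂ : Type*} [Finite V] [Nonempty V]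
    [Finite V₁] [Nonempty V₁] [Finite V₂] [Nonempty V₂] {G : SimpleGraph V}
    {G₁ : SimpleGraph V₁} {G₂ : SimpleGraph V₂}
    (h : hilbertSeries (binomialEdgeIdeal K G) = (1 - PowerSeries.X) ^ 2 *
      hilbertSeries (binomialEdgeIdeal K G₁) * hilbertSeries (binomialEdgeIdeal K G₂)) :
    edgeDim K G + 2 = edgeDim K G₁ + edgeDim K G₂ ∧
      ∀ e₁ e₂ : ℤ, IsMultiplicity (binomialEdgeIdeal K G₁) e₁ →
        IsMultiplicity (binomialEdgeIdeal K G₂) e₂ →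
        IsMultiplicity (binomialEdgeIdeal K G) (e₁ * e₂) := by
  obtain ⟨d₁, Q₁, p₁, hQ₁, n₁⟩ := exists_hilbertSeries_eq K G₁
  obtain ⟨d₂, Q₂, p₂, hQ₂, n₂⟩ := exists_hilbertSeries_eq K G₂
  obtain ⟨dim₁, m₁⟩ := edgeDim_and_isMultiplicity K G₁ p₁ hQ₁ n₁
  obtain ⟨dim₂, m₂⟩ := edgeDim_and_isMultiplicity K G₂ p₂ hQ₂ n₂
  have hQ : (1 - PowerSeries.X) ^ (d₁ + d₂ - 2) * hilbertSeries (binomialEdgeIdeal K G) =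
      ((Q₁ * Q₂ : Polynomial ℤ) : PowerSeries ℤ) := by
    rw [Polynomial.coe_mul, ← hQ₁, ← hQ₂, h]
    obtain ⟨a, rfl⟩ : ∃ a, d₁ = a + 1 := ⟨d₁ - 1, by omega⟩
    obtain ⟨b, rfl⟩ : ∃ b, d₂ = b + 1 := ⟨d₂ - 1, by omega⟩
    rw [show a + 1 + (b + 1) - 2 = a + b by omega]
    ring
  have hn : (Q₁ * Q₂).eval 1 ≠ 0 := by
    rw [Polynomial.eval_mul]
    exact mul_ne_zero n₁ n₂
  -- Exponent zero would make the Hilbert series a polynomial, but the Hilbert function never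
  -- vanishes.
  have hd : 0 < d₁ + d₂ - 2 := by
    by_contra h0
    rw [Nat.eq_zero_of_not_pos h0, pow_zero, one_mul] at hQ
    have := congrArg (PowerSeries.coeff ((Q₁ * Q₂).natDegree + 1)) hQ
    rw [Polynomial.coeff_coe, Polynomial.coeff_eq_zero_of_natDegree_lt (Nat.lt_succ_self _),
      hilbertSeries, PowerSeries.coeff_mk] at this
    exact hilbertFunction_binomialEdgeIdeal_ne_zero K G _ (by exact_mod_cast this)
  obtain ⟨dim, m⟩ := edgeDim_and_isMultiplicity K G hd hQ hn
  constructor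
  · rw [dim, dim₁, dim₂]
    have : d₁ + d₂ - 2 + 2 = d₁ + d₂ := by omega
    exact_mod_cast this
  · intro e₁ e₂ h₁ h₂
    rw [h₁.unique m₁, h₂.unique m₂, ← Polynomial.eval_mul]
    exact m

theorem exists_isMultiplicity [Finite V] [Nonempty V] (G : SimpleGraph V) :
    ∃ e, IsMultiplicity (binomialEdgeIdeal K G) e := by
  obtain ⟨d, Q, p, hQ, n⟩ := exists_hilbertSeries_eq K G
  exact ⟨_, (edgeDim_and_isMultiplicity K G p hQ n).2⟩

/-- Each edge at `v` extends to a maximal clique, and by uniqueness these cliques coincide. -/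
theorem IsFreeVertex.adj_of_adj [Finite V] {G : SimpleGraph V} {v : V} (h : IsFreeVertex G v)
    {i j : V} (hi : G.Adj v i) (hj : G.Adj v j) (hij : i ≠ j) : G.Adj i j := by
  have key : ∀ i, G.Adj v i → ∃ U : Set V, (Maximal G.IsClique U ∧ v ∈ U) ∧ i ∈ U := by
    intro i hi
    have hc : G.IsClique {v, i} := by
      rw [SimpleGraph.isClique_pair]
      exact fun _ => hi
    obtain ⟨U, hU, hmax⟩ := (Set.toFinite {U : Set V | G.IsClique U}).exists_le_maximal hc
    exact ⟨U, ⟨hmax, hU (Or.inl rfl)⟩, hU (Or.inr rfl)⟩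
  obtain ⟨U, hU, hiU⟩ := key i hi
  obtain ⟨U', hU', hjU⟩ := key j hj
  obtain rfl : U = U' := h.unique hU hU'
  exact hU.1.1 hiU hjU hij

variable {K}

theorem hilbertSeries_coe {G : SimpleGraph V} {H : G.Subgraph} (hH : H.IsInduced) :
    hilbertSeries (binomialEdgeIdeal K H.coe) = inducedSeries K G H.verts := by
  refine hilbertSeries_binomialEdgeIdeal_induce H.coe fun a b => ?_
  rw [SimpleGraph.Subgraph.coe_adj]
  exact ⟨fun h => h.adj_sub, fun h => hH a.2 b.2 h⟩

theorem isSimplicialIn_of_isFreeVertex [Finite V] {G : SimpleGraph V} {H : G.Subgraph}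
    (hH : H.IsInduced) {v : V} (h : ∃ hv : v ∈ H.verts, IsFreeVertex H.coe ⟨v, hv⟩) :
    IsSimplicialIn G H.verts v := by
  obtain ⟨hv, h⟩ := h
  intro i hi j hj hvi hvj hij
  have := h.adj_of_adj (i := ⟨i, hi⟩) (j := ⟨j, hj⟩) (hH hv hi hvi) (hH hv hj hvj)
    (fun h' => hij (congrArg Subtype.val h'))
  exact this.adj_sub

/-- As `H` is induced, an edge of `G` between the parts is an edge of `H₁` or of `H₂`, so one of its
ends lies in both parts and equals `v`. -/
theorem IsFreeGluing.isGluedAt [Finite V] {G : SimpleGraph V} {H H₁ H₂ : G.Subgraph} {v : V}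
    (h : IsFreeGluing H H₁ H₂ v) (hH : H.IsInduced) : IsGluedAt G H₁.verts H₂.verts v where
  inter_eq := h.inter_eq
  left := isSimplicialIn_of_isFreeVertex h.induced_left h.free_left
  right := isSimplicialIn_of_isFreeVertex h.induced_right h.free_right
  not_adj := by
    intro i hi j hj hiv hjv hij
    have hv : ∀ w, w ∈ H₁.verts → w ∈ H₂.verts → w = v := by
      intro w h1 h2
      have : w ∈ H₁.verts ∩ H₂.verts := ⟨h1, h2⟩
      rwa [h.inter_eq] at this
    have hi' : i ∈ H.verts := by rw [← h.union_eq]; exact Or.inl hi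
    have hj' : j ∈ H.verts := by rw [← h.union_eq]; exact Or.inr hj
    have hadj : H.Adj i j := hH hi' hj' hij
    rw [← h.union_eq, SimpleGraph.Subgraph.sup_adj] at hadj
    rcases hadj with hadj | hadj
    · exact hjv (hv j hadj.snd_mem hj)
    · exact hiv (hv i hi hadj.fst_mem)

theorem IsFreeGluing.hilbertSeries_eq [Finite V] {G : SimpleGraph V} {H H₁ H₂ : G.Subgraph}
    {v : V} (h : IsFreeGluing H H₁ H₂ v) (hH : H.IsInduced) :
    hilbertSeries (binomialEdgeIdeal K H.coe) = (1 - PowerSeries.X) ^ 2 *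
      hilbertSeries (binomialEdgeIdeal K H₁.coe) * hilbertSeries (binomialEdgeIdeal K H₂.coe) := by
  rw [hilbertSeries_coe hH, hilbertSeries_coe h.induced_left, hilbertSeries_coe h.induced_right,
    ← (h.isGluedAt hH).inducedSeries_eq, ← SimpleGraph.Subgraph.verts_sup, h.union_eq]

theorem hilbertSeries_top_coe (G : SimpleGraph V) :
    hilbertSeries (binomialEdgeIdeal K (⊤ : G.Subgraph).coe) =
      hilbertSeries (binomialEdgeIdeal K G) := by
  rw [hilbertSeries_coe (fun _ _ _ _ h => h), SimpleGraph.Subgraph.verts_top, inducedSeries,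
    inducedIdeal_univ]

/-- This passes between `G` and the graph of its top subgraph, whose ideals live in different
polynomial rings. -/
theorem edgeDim_congr {W : Type*} [Finite V] [Nonempty V] [Finite W] [Nonempty W]
    {G : SimpleGraph V} {F : SimpleGraph W}
    (h : hilbertSeries (binomialEdgeIdeal K G) = hilbertSeries (binomialEdgeIdeal K F)) :
    edgeDim K G = edgeDim K F ∧ ∀ e, IsMultiplicity (binomialEdgeIdeal K G) e →
      IsMultiplicity (binomialEdgeIdeal K F) e := by
  obtain ⟨d, Q, p, hQ, n⟩ := exists_hilbertSeries_eq K G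
  obtain ⟨h1, m1⟩ := edgeDim_and_isMultiplicity K G p hQ n
  rw [h] at hQ
  obtain ⟨h2, m2⟩ := edgeDim_and_isMultiplicity K F p hQ n
  exact ⟨h1.trans h2.symm, fun e he => he.unique m1 ▸ m2⟩

theorem IsDecomposition.length_pos {G : SimpleGraph V} {H : G.Subgraph} {L : List G.Subgraph}
    (h : IsDecomposition H L) : 0 < L.length := by
  induction h with
  | single H => simp
  | glue v h h₁ h₂ ih₁ ih₂ => simp [ih₁]

theorem IsDecomposition.verts_nonempty {G : SimpleGraph V} {H : G.Subgraph} {L : List G.Subgraph}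
    (h : IsDecomposition H L) (hH : H.verts.Nonempty) : ∀ H' ∈ L, H'.verts.Nonempty := by
  induction h with
  | single H => simpa using hH
  | glue v h h₁ h₂ ih₁ ih₂ =>
    intro H' hH'
    rcases List.mem_append.1 hH' with h' | h'
    · exact ih₁ ⟨v, h.free_left.1⟩ H' h'
    · exact ih₂ ⟨v, h.free_right.1⟩ H' h'

/-- The invariants of the members of a decomposition. -/
theorem IsDecomposition.formulas [Finite V] {G : SimpleGraph V} {H : G.Subgraph}
    {L : List G.Subgraph} (h : IsDecomposition H L) (hi : H.IsInduced) (hH : H.verts.Nonempty)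
    {m : G.Subgraph → ℤ} (hm : ∀ H : G.Subgraph, H.verts.Nonempty →
      IsMultiplicity (binomialEdgeIdeal K H.coe) (m H)) :
    hilbertSeries (binomialEdgeIdeal K H.coe) = (1 - PowerSeries.X) ^ (2 * L.length - 2) *
        (L.map fun H => hilbertSeries (binomialEdgeIdeal K H.coe)).prod ∧
      edgeDim K H.coe + ((2 * L.length - 2 : ℕ) : WithBot ℕ∞) =
        (L.map fun H => edgeDim K H.coe).sum ∧
      m H = (L.map m).prod := by
  induction h with
  | single H => simp
  | @glue H H₁ H₂ L₁ L₂ v h h₁ h₂ ih₁ ih₂ =>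
    have n₁ : H₁.verts.Nonempty := ⟨v, h.free_left.1⟩
    have n₂ : H₂.verts.Nonempty := ⟨v, h.free_right.1⟩
    obtain ⟨s₁, d₁, e₁⟩ := ih₁ h.induced_left n₁
    obtain ⟨s₂, d₂, e₂⟩ := ih₂ h.induced_right n₂
    have hs := h.hilbertSeries_eq (K := K) hi
    have := hH.to_subtype
    have := n₁.to_subtype
    have := n₂.to_subtype
    obtain ⟨hd, he⟩ := dim_and_multiplicity_of_hilbertSeries_eq K hs
    have l₁ := h₁.length_pos
    have l₂ := h₂.length_pos
    -- The truncated subtractions are exact because neither list is empty.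
    have hl : 2 * (L₁ ++ L₂).length - 2 = 2 + (2 * L₁.length - 2) + (2 * L₂.length - 2) := by
      rw [List.length_append]
      omega
    rw [hl, List.map_append, List.map_append, List.map_append, List.prod_append,
      List.sum_append, List.prod_append]
    refine ⟨?_, ?_, ?_⟩
    · rw [hs, s₁, s₂]
      ring
    · rw [← d₁, ← d₂, Nat.cast_add, Nat.cast_add, ← add_assoc, ← add_assoc,
        show ((2 : ℕ) : WithBot ℕ∞) = 2 from rfl, hd]
      ac_rfl
    · rw [← e₁, ← e₂]
      exact (hm H hH).unique (he _ _ (hm H₁ n₁) (hm H₂ n₂))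

end Graph

end BinomialEdge

open BinomialEdge in
theorem theorem3p3 {K V : Type*} [Field K] [Finite V] [Nonempty V] (G : SimpleGraph V) :
    (∀ (G₁ G₂ : G.Subgraph) (v : V), BinomialEdge.IsFreeGluing ⊤ G₁ G₂ v →
      BinomialEdge.hilbertSeries (BinomialEdge.binomialEdgeIdeal K G) =
          (1 - PowerSeries.X) ^ 2 *
            BinomialEdge.hilbertSeries (BinomialEdge.binomialEdgeIdeal K G₁.coe) *
            BinomialEdge.hilbertSeries (BinomialEdge.binomialEdgeIdeal K G₂.coe) ∧
        BinomialEdge.edgeDim K G + 2 =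
          BinomialEdge.edgeDim K G₁.coe + BinomialEdge.edgeDim K G₂.coe ∧
        ∃ e e₁ e₂ : ℤ,
          BinomialEdge.IsMultiplicity (BinomialEdge.binomialEdgeIdeal K G) e ∧
          BinomialEdge.IsMultiplicity (BinomialEdge.binomialEdgeIdeal K G₁.coe) e₁ ∧
          BinomialEdge.IsMultiplicity (BinomialEdge.binomialEdgeIdeal K G₂.coe) e₂ ∧
          e = e₁ * e₂) ∧
    (∀ L : List G.Subgraph, BinomialEdge.IsDecomposition ⊤ L →
      BinomialEdge.hilbertSeries (BinomialEdge.binomialEdgeIdeal K G) =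
          (1 - PowerSeries.X) ^ (2 * L.length - 2) *
            (L.map fun H =>
              BinomialEdge.hilbertSeries (BinomialEdge.binomialEdgeIdeal K H.coe)).prod ∧
        BinomialEdge.edgeDim K G + ((2 * L.length - 2 : ℕ) : WithBot ℕ∞) =
          (L.map fun H => BinomialEdge.edgeDim K H.coe).sum ∧
        ∃ (e : ℤ) (m : G.Subgraph → ℤ),
          BinomialEdge.IsMultiplicity (BinomialEdge.binomialEdgeIdeal K G) e ∧
          (∀ H ∈ L, BinomialEdge.IsMultiplicity (BinomialEdge.binomialEdgeIdeal K H.coe) (m H)) ∧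
          e = (L.map m).prod) := by
  have hind : (⊤ : G.Subgraph).IsInduced := fun _ _ _ _ h => h
  have hne : (⊤ : G.Subgraph).verts.Nonempty := Set.univ_nonempty
  have := hne.to_subtype
  have hs := hilbertSeries_top_coe (K := K) G
  obtain ⟨hd, htop⟩ := edgeDim_congr hs
  -- One multiplicity function for all subgraphs; its value on a subgraph without vertices is
  -- arbitrary, and no such subgraph occurs in a decomposition of `⊤`.
  choose! m hm using fun (H : G.Subgraph) (hH : H.verts.Nonempty) =>
    have := hH.to_subtype
    exists_isMultiplicity K H.coe
  refine ⟨fun G₁ G₂ v h => ?_, fun L h => ?_⟩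
  · have n₁ : G₁.verts.Nonempty := ⟨v, h.free_left.1⟩
    have n₂ : G₂.verts.Nonempty := ⟨v, h.free_right.1⟩
    have := n₁.to_subtype
    have := n₂.to_subtype
    have hG := hs.symm.trans (h.hilbertSeries_eq (K := K) hind)
    obtain ⟨h1, h2⟩ := dim_and_multiplicity_of_hilbertSeries_eq K hG
    exact ⟨hG, h1, _, _, _, h2 _ _ (hm G₁ n₁) (hm G₂ n₂), hm G₁ n₁, hm G₂ n₂, rfl⟩
  · obtain ⟨h1, h2, h3⟩ := h.formulas (K := K) hind hne hm
    rw [hs] at h1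
    rw [hd] at h2
    exact ⟨h1, h2, _, m, htop _ (hm ⊤ hne), fun H hH => hm H (h.verts_nonempty hne H hH), h3⟩
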